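/- Let $N\ge 2$ and $\nu\ge 1$ be integers and let $\mathbf N=[n_{ij}]$ be a $\nu\times\nu$ integer matrix with $|\det\mathbf N|=N$, all of whose complex eigenvalues have modulus greater than $1$. For $z\in\mathbb T^\nu$ put $z^{\mathbf N}=(z_1^{n_{11}}\cdots z_\nu^{n_{\nu1}},\dots,z_1^{n_{1\nu}}\cdots z_\nu^{n_{\nu\nu}})$, and let $e_n(z)=z^n$ ($n\in\mathbb Z^\nu$) be the Fourier basis of $L^2(\mathbb T^\nu)$. Let $m_j(z)=\sum_{n}a^{(j)}_n z^n$, $j=0,\dots,N-1$, be trigonometric polynomials (finitely many nonzero coefficients) such that for almost every $z\in\mathbb T^\nu$ the $N\times N$ matrix $\big(N^{-1/2}m_i(w_k)\big)_{i,k}$ is unitary, where $w_0,\dots,w_{N-1}$ are the solutions $w$ of $w^{\mathbf N}=z$. Define operators on $L^2(\mathbb T^\nu)$ by $(S_j\xi)(z)=m_j(z)\,\xi(z^{\mathbf N})$; call $(S_j)_j$ the polynomial representation given by these data. For a multi-index $I=(i_1,\dots,i_k)$ write $S_I=S_{i_1}\cdots S_{i_k}$ and $|I|=k$. For a finite set $H\subset\mathbb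 Z^\nu$ let $\mathcal K_H=\operatorname{span}\{e_m: m\in H\}$, and consider the conditions (a) for every $n\in\mathbb Z^\nu$ there is $M\in\mathbb N$ such that $S_I^*e_n\in\mathcal K_H$ for all $I$ with $|I|\ge M$; (b) $S_j^*\mathcal K_H\subset\mathcal K_H$ for all $j$. Then: 1. The $S_j$ satisfy the Cuntz relations $S_i^*S_j=\delta_{ij}1$, $\sum_jS_jS_j^*=1$, that is, they define a representation of the Cuntz algebra $\mathcal O_N$. Finite sets $H$ with (a) and (b) exist, and among them there is one that is minimal with respect to inclusion. 2. For every finite $H$ with (a), the finite-dimensional space $\mathcal K_H$ is cyclic for the representation. The representation is finitely correlated: there is a finite-dimensional cyclic subspace that is invariant under all $S_j^*$. Now let $H$ be a finite set with (a) and (b) (for example a minimal one), let $\mathcal K=\mathcal K_H$, let $P$ be the orthogonal projection onto $\mathcal K$, define $V_j\in\mathcal B(\mathcal K)$ by $V_j^*e_n=\sum_{m\in H}\overline{a^{(j)}_{n-\mathbf Nm}}\,e_m$ for $n\in H$, and let $\sigma(A)=\sum_kV_kAV_k^*$ for $A\in\mathcal B(\mathcal K)$. 3. The map $X\mapsto PXP$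 is an isometric linear order isomorphism from the commutant $\{S_j,S_j^*\}'$ onto $\mathcal B(\mathcal K)^\sigma=\{A\in\mathcal B(\mathcal K):\sigma(A)=A\}$. 4. The representation is irreducible if and only if $\mathcal B(\mathcal K)^\sigma=\mathbb C1$. 5. If the representation is irreducible, then the peripheral spectrum of $\sigma$ (the spectral values whose modulus is the spectral radius) is a finite cyclic subgroup of $\mathbb T$, and if $k$ is its order, the restriction of the representation to $\mathrm{UHF}_N$ (represented by the norm closure of the linear span of the operators $S_IS_J^*$ with $|I|=|J|$) is the orthogonal direct sum of $k$ irreducible representations that are mutually disjoint, i.e. have no nonzero bounded intertwiners between them. 6. Let $(T_j)_j$ be a second polynomial representation with the same $N$, on $L^2(\mathbb T^{\nu'})$ (the eigenvalue condition is not needed for its matrix), let $H'\subset\mathbb Z^{\nu'}$ be a finite set with (a) and (b) for it, let $\mathcal K'$, $P'$ be the corresponding subspace and projection, and let $W_j$ be the operators on $\mathcal K'$ corresponding to the $V_j$. Then $U\mapsto P'UP$ is an isometric linear isomorphism from $\{U: US_j=T_jU\text{ for all }j\}$ onto $\{A\in\mathcal B(\mathcal K,\mathcal K'):\sum_jW_jAV_j^*=A\}$.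 -/

import Mathlib

open MeasureTheory
open scoped ENNReal InnerProductSpace

noncomputable section

/-! ### Representations of the Cuntz relations

A representation of the Cuntz algebra `𝒪_N` on a Hilbert space `E` is given by the images
`S 0, …, S (N - 1)` of its generators, i.e. by a family of operators satisfying the Cuntz
relations. -/

section Cuntz

variable {N : ℕ} {E E' : Type*}
  [NormedAddCommGroup E] [InnerProductSpace ℂ E] [CompleteSpace E]
  [NormedAddCommGroup E'] [InnerProductSpace ℂ E'] [CompleteSpace E']

/-- The Cuntz relations `Sᵢ* Sⱼ = δᵢⱼ 1` and `∑ⱼ Sⱼ Sⱼ* = 1`. -/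
def IsCuntzFamily (S : Fin N → E →L[ℂ] E) : Prop :=
  (∀ i j, star (S i) * S j = if i = j then 1 else 0) ∧ ∑ j, S j * star (S j) = 1

/-- `S_I = S_{i₁} ⋯ S_{iₖ}` for a multi-index `I = (i₁, …, iₖ)`. -/
def cuntzWord (S : Fin N → E →L[ℂ] E) (I : List (Fin N)) : E →L[ℂ] E :=
  (I.map S).prod

/-- The image of `𝒪_N`: the C⋆-algebra generated by the operators `Sᵢ`. -/
def cuntzAlgebra (S : Fin N → E →L[ℂ] E) : Set (E →L[ℂ] E) :=
  ((StarAlgebra.adjoin ℂ (Set.range S)).topologicalClosure : Set (E →L[ℂ] E))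

/-- The image of `UHF_N`: the norm closure of the linear span of the
monomials `S_I S_J*` with `|I| = |J|`. -/
def uhfAlgebra (S : Fin N → E →L[ℂ] E) : Set (E →L[ℂ] E) :=
  ((Submodule.span ℂ {A | ∃ I J : List (Fin N), I.length = J.length ∧
    A = cuntzWord S I * star (cuntzWord S J)}).topologicalClosure : Set (E →L[ℂ] E))

/-- The commutant `{Sᵢ, Sᵢ*}'` of the representation. -/
def commutant (S : Fin N → E →L[ℂ] E) : Submodule ℂ (E →L[ℂ] E) :=
  Subalgebra.toSubmodule (StarSubalgebra.centralizer ℂ (Set.range S)).toSubalgebra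

/-- Bounded operators `U` with `U Sᵢ = Tᵢ U` for all `i`. -/
def intertwiners (S : Fin N → E →L[ℂ] E) (T : Fin N → E' →L[ℂ] E') :
    Submodule ℂ (E →L[ℂ] E') where
  carrier := {U | ∀ i, U ∘L S i = T i ∘L U}
  add_mem' := by
    intro a b ha hb i
    rw [ContinuousLinearMap.add_comp, ContinuousLinearMap.comp_add, ha i, hb i]
  zero_mem' := by intro i; simp
  smul_mem' := by
    intro c a ha i
    rw [ContinuousLinearMap.smul_comp, ContinuousLinearMap.comp_smul, ha i]

/-- `K` is cyclic: the vectors `A x` with `A` in the image of `𝒪_N` and `x ∈ K` span a dense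
subspace. -/
def IsCyclicSubspace (S : Fin N → E →L[ℂ] E) (K : Submodule ℂ E) : Prop :=
  (Submodule.span ℂ {y | ∃ A ∈ cuntzAlgebra S, ∃ x ∈ K, y = A x}).topologicalClosure = ⊤

/-- There is a finite-dimensional cyclic subspace that is invariant under all `Sᵢ*`. -/
def IsFinitelyCorrelated (S : Fin N → E →L[ℂ] E) : Prop :=
  ∃ K : Submodule ℂ E, FiniteDimensional ℂ K ∧ (∀ i, ∀ x ∈ K, star (S i) x ∈ K) ∧
    IsCyclicSubspace S K

/-- The closed subspace `W` is invariant under `𝒜`. -/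
def IsClosedInvariant (𝒜 : Set (E →L[ℂ] E)) (W : Submodule ℂ E) : Prop :=
  IsClosed (W : Set E) ∧ ∀ A ∈ 𝒜, ∀ x ∈ W, A x ∈ W

/-- `𝒜` acts irreducibly on `W`: `W` is a nonzero closed invariant subspace, and the only closed
invariant subspaces contained in `W` are `0` and `W`. -/
def IsIrreducibleOn (𝒜 : Set (E →L[ℂ] E)) (W : Submodule ℂ E) : Prop :=
  W ≠ ⊥ ∧ IsClosedInvariant 𝒜 W ∧ ∀ U, IsClosedInvariant 𝒜 U → U ≤ W → U = ⊥ ∨ U = W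

/-- The representation `S` of `𝒪_N` is irreducible. -/
def IsIrreducibleRep (S : Fin N → E →L[ℂ] E) : Prop :=
  IsIrreducibleOn (cuntzAlgebra S) ⊤

/-- The restrictions of `𝒜` to two invariant subspaces `U` and `W` are disjoint: there is no nonzero
bounded intertwining operator `U → W`. -/
def AreDisjointOn (𝒜 : Set (E →L[ℂ] E)) (U W : Submodule ℂ E) : Prop :=
  ∀ T : U →L[ℂ] W, (∀ A ∈ 𝒜, ∀ x y : U, (y : E) = A x → (T y : E) = A (T x)) → T = 0

/-- The map `A ↦ ∑ᵢ Wᵢ A Vᵢ*`. -/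
def transferMap (V : Fin N → E →L[ℂ] E) (W : Fin N → E' →L[ℂ] E') :
    (E →L[ℂ] E') →L[ℂ] (E →L[ℂ] E') :=
  ∑ i, (ContinuousLinearMap.compL ℂ E E' E' (W i)) ∘L
    ((ContinuousLinearMap.compL ℂ E E E').flip (star (V i)))

theorem transferMap_apply (V : Fin N → E →L[ℂ] E) (W : Fin N → E' →L[ℂ] E') (A : E →L[ℂ] E') :
    transferMap V W A = ∑ i, W i ∘L A ∘L star (V i) := by
  simp [transferMap]

/-- The fixed points of `A ↦ ∑ᵢ Wᵢ A Vᵢ*`. -/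
def transferFixedPoints (V : Fin N → E →L[ℂ] E) (W : Fin N → E' →L[ℂ] E') :
    Submodule ℂ (E →L[ℂ] E') where
  carrier := {A | transferMap V W A = A}
  add_mem' := by
    intro a b ha hb
    simp only [Set.mem_ofPred_eq] at ha hb ⊢
    rw [map_add, ha, hb]
  zero_mem' := by simp
  smul_mem' := by
    intro c a ha
    simp only [Set.mem_ofPred_eq] at ha ⊢
    rw [map_smul, ha]

/-- The compression `U ↦ P' U P`, as an operator `K → K'`, where `P` and `P'` are the orthogonal
projections onto `K` and `K'`. -/
def compress (K : Submodule ℂ E) (K' : Submodule ℂ E') [K'.HasOrthogonalProjection]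
    (U : E →L[ℂ] E') : K →L[ℂ] K' :=
  K'.orthogonalProjectionOnto ∘L U ∘L K.subtypeL

end Cuntz

/-- The spectral values of largest modulus. -/
def peripheralSpectrum {A : Type*} [Ring A] [Algebra ℂ A] (a : A) : Set ℂ :=
  {z | z ∈ spectrum ℂ a ∧ ‖z‖ₑ = spectralRadius ℂ a}

/-! ### The torus -/

/-- Normalized Haar measure on `𝕋^ν = (ℝ/ℤ)^ν`. -/
abbrev torusHaar (ν : ℕ) : Measure (UnitAddTorus (Fin ν)) :=
  Measure.pi fun _ => AddCircle.haarAddCircle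

/-- The Hilbert space `L²(𝕋^ν)`. -/
abbrev TorusL2 (ν : ℕ) : Type := Lp ℂ 2 (torusHaar ν)

/-- The Fourier basis vector `eₙ(z) = zⁿ`, `n ∈ ℤ^ν`. -/
def fourierVec {ν : ℕ} (n : Fin ν → ℤ) : TorusL2 ν :=
  ContinuousMap.toLp 2 (torusHaar ν) ℂ (UnitAddTorus.mFourier n)

/-- The span of the `eₘ` with `m ∈ H`. -/
def fourierSpan {ν : ℕ} (H : Finset (Fin ν → ℤ)) : Submodule ℂ (TorusL2 ν) :=
  Submodule.span ℂ (fourierVec '' (H : Set (Fin ν → ℤ)))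

instance {ν : ℕ} (H : Finset (Fin ν → ℤ)) : FiniteDimensional ℂ (fourierSpan H) :=
  FiniteDimensional.span_of_finite ℂ (H.finite_toSet.image _)

instance {ν : ℕ} (H : Finset (Fin ν → ℤ)) : CompleteSpace (fourierSpan H) :=
  FiniteDimensional.complete ℂ _

/-- For `m ∈ H`, the vector `eₘ` as an element of the span. -/
def spanVec {ν : ℕ} {H : Finset (Fin ν → ℤ)} (m : H) : fourierSpan H :=
  ⟨fourierVec m.1, Submodule.subset_span ⟨m.1, m.2, rfl⟩⟩

/-- The endomorphism `z ↦ z^M` of `𝕋^ν`, whose `j`-th coordinate is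
`z₁ ^ M₁ⱼ ⋯ z_ν ^ M_νⱼ` (written additively). -/
def torusPow {ν : ℕ} (M : Matrix (Fin ν) (Fin ν) ℤ) :
    UnitAddTorus (Fin ν) →+ UnitAddTorus (Fin ν) where
  toFun t := fun j => ∑ i, M i j • t i
  map_zero' := by ext j; simp
  map_add' s t := by ext j; simp [smul_add, Finset.sum_add_distrib]

theorem continuous_torusPow {ν : ℕ} (M : Matrix (Fin ν) (Fin ν) ℤ) :
    Continuous (torusPow M) := by
  refine continuous_pi fun j => ?_
  change Continuous fun t : UnitAddTorus (Fin ν) => ∑ i, M i j • t i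
  exact continuous_finsetSum _ fun i _ => (continuous_apply i).zsmul _

theorem surjective_torusPow {ν : ℕ} {M : Matrix (Fin ν) (Fin ν) ℤ} (hM : M.det ≠ 0) :
    Function.Surjective (torusPow M) := by
  intro t
  choose y hy using fun j => QuotientAddGroup.mk_surjective (t j)
  set R : Matrix (Fin ν) (Fin ν) ℝ := (M.map (Int.castRingHom ℝ)).transpose with hR
  have hdet : IsUnit R.det := by
    rw [hR, Matrix.det_transpose, ← RingHom.mapMatrix_apply, ← RingHom.map_det]
    exact isUnit_iff_ne_zero.mpr (by simpa using hM)
  refine ⟨fun i => ((R⁻¹.mulVec y) i : ℝ), ?_⟩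
  funext j
  change ∑ i, M i j • (((R⁻¹.mulVec y) i : ℝ) : UnitAddCircle) = t j
  have h : R.mulVec (R⁻¹.mulVec y) j = y j := by
    rw [Matrix.mulVec_mulVec, Matrix.mul_nonsing_inv _ hdet, Matrix.one_mulVec]
  rw [← hy j]
  change _ = ((y j : ℝ) : UnitAddCircle)
  rw [← h, Matrix.mulVec, dotProduct]
  simp only [hR, Matrix.transpose_apply, Matrix.map_apply, eq_intCast]
  rw [← QuotientAddGroup.mk'_apply, map_sum]
  refine Finset.sum_congr rfl fun i _ => ?_
  rw [← zsmul_eq_mul, map_zsmul]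
  rfl

theorem measurePreserving_torusPow {ν : ℕ} {M : Matrix (Fin ν) (Fin ν) ℤ} (hM : M.det ≠ 0) :
    MeasurePreserving (torusPow M) (torusHaar ν) (torusHaar ν) :=
  (torusPow M).measurePreserving (continuous_torusPow M) (surjective_torusPow hM) rfl

/-! ### Polynomial representations -/

/-- The trigonometric polynomial `∑ₙ aₙ zⁿ` on `𝕋^ν`. -/
def trigPoly {ν : ℕ} (a : (Fin ν → ℤ) →₀ ℂ) : C(UnitAddTorus (Fin ν), ℂ) :=
  a.sum fun n c => c • UnitAddTorus.mFourier n

/-- The data of a polynomial representation: an integer matrix with `|det| = N ≥ 2` and the coefficients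
`a^{(j)}` of the trigonometric polynomials `m_j`, `j = 0, …, N - 1`. The last field is the unitarity
condition: for almost all `z`, with `σ₀(z), …, σ_{N-1}(z)` the `N` points that the map `w ↦ w^M`
sends to `z`, the matrix with entries `N^{-1/2} m_i(σ_k(z))` is unitary. -/
structure PolynomialFilterBank (N ν : ℕ) where
  mat : Matrix (Fin ν) (Fin ν) ℤ
  two_le : 2 ≤ N
  natAbs_det : mat.det.natAbs = N
  coeff : Fin N → (Fin ν → ℤ) →₀ ℂ
  unitary : ∀ᵐ z ∂(torusHaar ν), ∃ σ : Fin N ≃ {w // torusPow mat w = z},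
    Matrix.of (fun i k : Fin N => ((√N)⁻¹ : ℂ) * trigPoly (coeff i) (σ k).1) ∈
      Matrix.unitaryGroup (Fin N) ℂ

namespace PolynomialFilterBank

variable {N ν : ℕ} (F : PolynomialFilterBank N ν)

theorem det_ne_zero : F.mat.det ≠ 0 := by
  intro h
  have h1 := F.natAbs_det
  have h2 := F.two_le
  rw [h, Int.natAbs_zero] at h1
  omega

/-- All complex eigenvalues of the matrix have modulus greater than `1`. -/
def IsExpansive : Prop :=
  ∀ z ∈ spectrum ℂ (F.mat.map (Int.castRingHom ℂ)), 1 < ‖z‖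

/-- The operator `(S_j ξ)(z) = m_j(z) ξ(z^M)` on `L²(𝕋^ν)`. -/
def rep (j : Fin N) : TorusL2 ν →L[ℂ] TorusL2 ν :=
  ((ContinuousLinearMap.mul ℂ ℂ).holderL (torusHaar ν) ∞ 2 2
      (ContinuousMap.toLp ∞ (torusHaar ν) ℂ (trigPoly (F.coeff j)))) ∘L
    (Lp.compMeasurePreservingₗᵢ ℂ (torusPow F.mat)
      (measurePreserving_torusPow F.det_ne_zero)).toContinuousLinearMap

theorem rep_apply_ae (j : Fin N) (ξ : TorusL2 ν) :
    F.rep j ξ =ᵐ[torusHaar ν] fun z => trigPoly (F.coeff j) z * ξ (torusPow F.mat z) := by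
  have h1 := ContinuousLinearMap.coeFn_holder (r := 2) (ContinuousLinearMap.mul ℂ ℂ)
    (ContinuousMap.toLp ∞ (torusHaar ν) ℂ (trigPoly (F.coeff j)))
    (Lp.compMeasurePreserving (torusPow F.mat) (measurePreserving_torusPow F.det_ne_zero) ξ)
  have h2 := ContinuousMap.coeFn_toLp (p := ∞) (𝕜 := ℂ) (torusHaar ν) (trigPoly (F.coeff j))
  have h3 := Lp.coeFn_compMeasurePreserving ξ (measurePreserving_torusPow F.det_ne_zero)
  filter_upwards [h1, h2, h3] with z h1 h2 h3
  refine Eq.trans h1 ?_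
  rw [h2, h3]
  rfl

/-- For every `n` there is an `L` such that `S_I* eₙ ∈ span {eₘ | m ∈ H}` for all
multi-indices `I` with `|I| ≥ L`. -/
def IsAbsorbing (H : Finset (Fin ν → ℤ)) : Prop :=
  ∀ n : Fin ν → ℤ, ∃ L : ℕ, ∀ I : List (Fin N), L ≤ I.length →
    star (cuntzWord F.rep I) (fourierVec n) ∈ fourierSpan H

/-- `span {eₘ | m ∈ H}` is invariant under all `S_j*`. -/
def IsCoinvariant (H : Finset (Fin ν → ℤ)) : Prop :=
  ∀ j, ∀ x ∈ fourierSpan H, star (F.rep j) x ∈ fourierSpan H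

/-- The operator `V_j*` on `span {eₘ | m ∈ H}`, determined by
`V_j* eₙ = ∑_{m ∈ H} conj (a^{(j)}_{n - M m}) eₘ` for `n ∈ H`; here
`rankOne x y` is the operator `z ↦ ⟪y, z⟫ x`. -/
def coreAdjoint (H : Finset (Fin ν → ℤ)) (j : Fin N) : fourierSpan H →L[ℂ] fourierSpan H :=
  ∑ n : H, ∑ m : H, (starRingEnd ℂ) (F.coeff j (n.1 - F.mat.mulVec m.1)) •
    InnerProductSpace.rankOne ℂ (spanVec m) (spanVec n)

theorem coreAdjoint_apply (H : Finset (Fin ν → ℤ)) (j : Fin N) (n : H) :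
    F.coreAdjoint H j (spanVec n) =
      ∑ m : H, (starRingEnd ℂ) (F.coeff j (n.1 - F.mat.mulVec m.1)) • spanVec m := by
  have ho : Orthonormal ℂ (fourierVec (ν := ν)) := UnitAddTorus.orthonormal_mFourier
  have hi : ∀ k : H, ⟪spanVec k, spanVec n⟫_ℂ = if k = n then 1 else 0 := by
    intro k
    have h := orthonormal_iff_ite.mp ho k.1 n.1
    rw [Submodule.coe_inner]
    refine h.trans ?_
    by_cases hk : k = n
    · rw [if_pos hk, if_pos (congrArg Subtype.val hk)]
    · rw [if_neg hk, if_neg fun h' => hk (Subtype.ext h')]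
  simp only [coreAdjoint, sum_apply, smul_apply,
    InnerProductSpace.rankOne_apply, hi]
  rw [Finset.sum_eq_single n]
  · simp
  · intro k _ hk; simp [hk]
  · simp

/-- The operators `V_j` on `span {eₘ | m ∈ H}`. -/
def core (H : Finset (Fin ν → ℤ)) (j : Fin N) : fourierSpan H →L[ℂ] fourierSpan H :=
  star (F.coreAdjoint H j)

end PolynomialFilterBank

end

/-! Write Σ(X) = ∑ S_j X S_j*, or ∑ T_j X S_j* for two families. By the Cuntz relations Σ is a
contraction whose fixed points are exactly the intertwiners. If K is invariant under the S_j*,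
compression to K carries Σ to the finite-dimensional map σ. Moreover ⟪y, Σⁿ(U) x⟫ involves U only
between vectors S_I* x and T_I* y with |I| = n; when all of these lie in the cores, the coefficient
is controlled by the compression of U alone (`norm_inner_transferMap_pow_le`). Condition (a) makes
such vectors dense. Hence compression is isometric and order-reflecting on fixed points. It is onto:
extend a σ-fixed A by zero and iterate Σ; the matrix coefficients between absorbed vectors become
constant, and a weak limit is a fixed point (`exists_compress_eq`).

The commutant is therefore finite-dimensional, and eigenvectors of left multiplication give Schur's
lemma without spectral theory.

For |c| = 1, the equation Σ(U) = cU says that U intertwines (S_j) with (c⁻¹S_j), which has the same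
absorbed vectors, so unimodular eigenvectors of σ lift to Σ. It also reads c U S_j = S_j U, so
eigenvectors multiply along with their eigenvalues. In the irreducible case U*U is scalar, nonzero
eigenvectors are multiples of unitaries, and the peripheral eigenvalues form a finite, hence cyclic,
group.

On the commutant of UHF_N, Σ is a bijection with contractive inverse X ↦ S_i* X S_i. Because σ maps
the finite-dimensional compressed commutant onto itself, compression is injective there
(`eq_zero_of_mem_uhfCommutant`). So Σ is diagonalizable on this commutant with unimodular
eigenvalues. Under irreducibility each eigenspace is spanned by a power of one operator U with U^k =
1, and the k eigenspaces of U are the irreducible, mutually disjoint summands.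

For polynomial representations, the Cuntz relations are the row and column orthogonality of the
filter matrix, summed over the cosets of the finite kernel of z ↦ z^M. Since S_j* e_n combines
vectors e_m with M m = n − l, l in the support of m_j, an expansive M pulls exponents into a fixed
finite set, which gives H. -/

noncomputable section

/-! ### Weak compactness of bounded sequences of operators -/

section WeakLimit

variable {E E' : Type*}
  [NormedAddCommGroup E] [InnerProductSpace ℂ E]
  [NormedAddCommGroup E'] [InnerProductSpace ℂ E'] [CompleteSpace E']

/-- A norm bounded sequence of operators has a weak limit along every ultrafilter. -/
theorem exists_weak_limit (u : Ultrafilter ℕ) (U : ℕ → E →L[ℂ] E') {C : ℝ}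
    (hU : ∀ n, ‖U n‖ ≤ C) :
    ∃ A : E →L[ℂ] E', ∀ x y,
      Filter.Tendsto (fun n => ⟪y, U n x⟫_ℂ) u (nhds ⟪y, A x⟫_ℂ) := by
  have hb : ∀ n x y, ‖⟪U n x, y⟫_ℂ‖ ≤ C * ‖x‖ * ‖y‖ := by
    intro n x y
    refine (norm_inner_le_norm _ _).trans ?_
    gcongr
    exact ((U n).le_opNorm x).trans (by gcongr; exact hU n)
  have hlim : ∀ x y, ∃ g : ℂ, Filter.Tendsto (fun n => ⟪U n x, y⟫_ℂ) u (nhds g) := by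
    intro x y
    have hc : IsCompact (Metric.closedBall (0 : ℂ) (C * ‖x‖ * ‖y‖)) := isCompact_closedBall _ _
    obtain ⟨g, -, hg⟩ := hc.ultrafilter_le_nhds (u.map fun n => ⟪U n x, y⟫_ℂ) (by
      rw [Filter.le_principal_iff, Ultrafilter.coe_map, Filter.mem_map]
      refine Filter.univ_mem' fun n => ?_
      simpa using hb n x y)
    exact ⟨g, hg⟩
  choose g hg using hlim
  have hgb : ∀ x y, ‖g x y‖ ≤ C * ‖x‖ * ‖y‖ := by
    intro x y
    have h : Filter.Tendsto (fun n => ‖⟪U n x, y⟫_ℂ‖) u (nhds ‖g x y‖) := (hg x y).norm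
    exact le_of_tendsto h (Filter.Eventually.of_forall fun n => hb n x y)
  -- The limit form is linear in y and conjugate-linear in x, so the Riesz representation of y ↦ g x
  -- y is linear in x.
  let l : E → StrongDual ℂ E' := fun x =>
    LinearMap.mkContinuous
      { toFun := g x
        map_add' := fun y z => tendsto_nhds_unique (hg x (y + z)) (by
          simpa only [inner_add_right] using (hg x y).add (hg x z))
        map_smul' := fun c y => tendsto_nhds_unique (hg x (c • y)) (by
          simpa only [inner_smul_right, RingHom.id_apply, smul_eq_mul] using (hg x y).const_mul c) } (C * ‖x‖) (hgb x)
  have hl : ∀ x y, ⟪(InnerProductSpace.toDual ℂ E').symm (l x), y⟫_ℂ = g x y := fun x y => by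
    rw [InnerProductSpace.toDual_symm_apply]; rfl
  let A : E →L[ℂ] E' := LinearMap.mkContinuous
    { toFun := fun x => (InnerProductSpace.toDual ℂ E').symm (l x)
      map_add' := fun x y => ext_inner_right ℂ fun z => by
        rw [inner_add_left, hl, hl, hl]
        exact tendsto_nhds_unique (hg (x + y) z) (by
          simpa only [map_add, inner_add_left] using (hg x z).add (hg y z))
      map_smul' := fun c x => ext_inner_right ℂ fun z => by
        rw [RingHom.id_apply, inner_smul_left, hl, hl]
        exact tendsto_nhds_unique (hg (c • x) z) (by
          simpa only [map_smul, inner_smul_left] using (hg x z).const_mul _) } C (by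
      intro x
      change ‖(InnerProductSpace.toDual ℂ E').symm (l x)‖ ≤ _
      rw [LinearIsometryEquiv.norm_map]
      refine LinearMap.mkContinuous_norm_le _ ?_ _
      exact mul_nonneg ((norm_nonneg _).trans (hU 0)) (norm_nonneg x))
  refine ⟨A, fun x y => ?_⟩
  have h := (Complex.continuous_conj.tendsto _).comp (hg x y)
  rw [← hl x y] at h
  simp only [Function.comp_def, inner_conj_symm] at h
  exact h

end WeakLimit

/-! ### Lifting fixed points from the core to intertwiners -/

section CuntzLifting

variable {N : ℕ} {E E' : Type*}
  [NormedAddCommGroup E] [InnerProductSpace ℂ E] [CompleteSpace E]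
  [NormedAddCommGroup E'] [InnerProductSpace ℂ E'] [CompleteSpace E']
  {S : Fin N → E →L[ℂ] E} {T : Fin N → E' →L[ℂ] E'}

theorem star_apply_inner_left (A : E →L[ℂ] E) (x y : E) : ⟪star A x, y⟫_ℂ = ⟪x, A y⟫_ℂ := by
  rw [ContinuousLinearMap.star_eq_adjoint, ContinuousLinearMap.adjoint_inner_left]

theorem star_apply_inner_right (A : E →L[ℂ] E) (x y : E) : ⟪x, star A y⟫_ℂ = ⟪A x, y⟫_ℂ := by
  rw [ContinuousLinearMap.star_eq_adjoint, ContinuousLinearMap.adjoint_inner_right]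

theorem IsCuntzFamily.star_apply_apply (hS : IsCuntzFamily S) (i j : Fin N) (x : E) :
    star (S i) (S j x) = if i = j then x else 0 := by
  have h := congrArg (fun A : E →L[ℂ] E => A x) (hS.1 i j)
  change star (S i) (S j x) = _ at h
  rw [h]
  split_ifs <;> rfl

theorem IsCuntzFamily.sum_apply_star_apply (hS : IsCuntzFamily S) (x : E) :
    ∑ j, S j (star (S j) x) = x := by
  have h := congrArg (fun A : E →L[ℂ] E => A x) hS.2
  simpa using h

theorem IsCuntzFamily.sum_norm_sq (hS : IsCuntzFamily S) (x : E) :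
    ∑ j, ‖star (S j) x‖ ^ 2 = ‖x‖ ^ 2 := by
  have h : ((∑ j, ‖star (S j) x‖ ^ 2 : ℝ) : ℂ) = ((‖x‖ ^ 2 : ℝ) : ℂ) := by
    push_cast
    refine Eq.trans ?_ (inner_self_eq_norm_sq_to_K (𝕜 := ℂ) x)
    conv_rhs => rw [← hS.sum_apply_star_apply x, sum_inner]
    refine Finset.sum_congr rfl fun j _ => ?_
    rw [hS.sum_apply_star_apply x, ← star_apply_inner_right]
    exact (inner_self_eq_norm_sq_to_K (𝕜 := ℂ) (star (S j) x)).symm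
  exact_mod_cast h

theorem IsCuntzFamily.norm_apply (hS : IsCuntzFamily S) (j : Fin N) (x : E) :
    ‖S j x‖ = ‖x‖ := by
  have h : ⟪S j x, S j x⟫_ℂ = ⟪x, x⟫_ℂ := by
    rw [← star_apply_inner_right, hS.star_apply_apply, if_pos rfl]
  rw [inner_self_eq_norm_sq_to_K, inner_self_eq_norm_sq_to_K] at h
  have h' : ‖S j x‖ ^ 2 = ‖x‖ ^ 2 := by exact_mod_cast h
  exact (pow_left_inj₀ (norm_nonneg _) (norm_nonneg _) two_ne_zero).mp h'

theorem IsCuntzFamily.smul (hS : IsCuntzFamily S) {c : ℂ} (hc : ‖c‖ = 1) :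
    IsCuntzFamily fun j => c • S j := by
  have h1 : (starRingEnd ℂ) c * c = 1 := by rw [Complex.conj_mul', hc]; simp
  refine ⟨fun i j => ?_, ?_⟩
  · rw [star_smul, smul_mul_smul_comm, hS.1 i j]
    change ((starRingEnd ℂ) c * c) • _ = _
    rw [h1, one_smul]
  · rw [← hS.2]
    refine Finset.sum_congr rfl fun j _ => ?_
    rw [star_smul, smul_mul_smul_comm, mul_comm]
    change ((starRingEnd ℂ) c * c) • _ = _
    rw [h1, one_smul]

theorem inner_transferMap_apply (S : Fin N → E →L[ℂ] E) (T : Fin N → E' →L[ℂ] E')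
    (U : E →L[ℂ] E') (x : E) (y : E') :
    ⟪y, transferMap S T U x⟫_ℂ = ∑ j, ⟪star (T j) y, U (star (S j) x)⟫_ℂ := by
  rw [transferMap_apply, sum_apply, inner_sum]
  refine Finset.sum_congr rfl fun j _ => ?_
  rw [star_apply_inner_left]
  rfl

/-- Cauchy–Schwarz over j combined with ∑ ‖S_j* x‖² = ‖x‖². The bound is assumed only at the vectors
S_j* x and T_j* y, so that the same estimate can be iterated on absorbed vectors. -/
theorem norm_inner_transferMap_le (hS : IsCuntzFamily S) (hT : IsCuntzFamily T)
    (U : E →L[ℂ] E') {C : ℝ} (hC : 0 ≤ C) (x : E) (y : E')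
    (h : ∀ j, ‖⟪star (T j) y, U (star (S j) x)⟫_ℂ‖ ≤ C * ‖star (S j) x‖ * ‖star (T j) y‖) :
    ‖⟪y, transferMap S T U x⟫_ℂ‖ ≤ C * ‖x‖ * ‖y‖ := by
  rw [inner_transferMap_apply]
  refine (norm_sum_le _ _).trans ((Finset.sum_le_sum fun j _ => h j).trans ?_)
  simp only [mul_assoc]
  rw [← Finset.mul_sum]
  refine mul_le_mul_of_nonneg_left ?_ hC
  refine (Real.sum_mul_le_sqrt_mul_sqrt _ _ _).trans (le_of_eq ?_)
  rw [hS.sum_norm_sq, hT.sum_norm_sq, Real.sqrt_sq (norm_nonneg _), Real.sqrt_sq (norm_nonneg _)]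

theorem norm_le_of_norm_inner_le (A : E →L[ℂ] E') {C : ℝ} (hC : 0 ≤ C)
    (h : ∀ x y, ‖⟪y, A x⟫_ℂ‖ ≤ C * ‖x‖ * ‖y‖) : ‖A‖ ≤ C := by
  refine A.opNorm_le_bound hC fun x => ?_
  have h1 := h x (A x)
  rw [inner_self_eq_norm_sq_to_K, norm_pow] at h1
  simp only [Complex.coe_algebraMap, Complex.norm_real, norm_norm] at h1
  rcases (norm_nonneg (A x)).eq_or_lt with h0 | h0
  · rw [← h0]; positivity
  · nlinarith

theorem norm_transferMap_le (hS : IsCuntzFamily S) (hT : IsCuntzFamily T) (U : E →L[ℂ] E') :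
    ‖transferMap S T U‖ ≤ ‖U‖ := by
  refine norm_le_of_norm_inner_le _ (norm_nonneg _) fun x y => ?_
  refine norm_inner_transferMap_le hS hT U (norm_nonneg _) x y fun j => ?_
  refine (norm_inner_le_norm _ _).trans ?_
  rw [mul_comm]
  gcongr
  exact U.le_opNorm _

theorem norm_transferMap_pow_le (hS : IsCuntzFamily S) (hT : IsCuntzFamily T) (n : ℕ)
    (U : E →L[ℂ] E') : ‖(transferMap S T ^ n) U‖ ≤ ‖U‖ := by
  induction n with
  | zero => simp
  | succ n ih =>
    rw [pow_succ']
    exact (norm_transferMap_le hS hT _).trans ih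

theorem transferMap_comp_apply (hS : IsCuntzFamily S) (U : E →L[ℂ] E') (i : Fin N) :
    transferMap S T U ∘L S i = T i ∘L U := by
  ext x
  simp only [transferMap_apply, ContinuousLinearMap.comp_apply, sum_apply,
    hS.star_apply_apply]
  rw [Finset.sum_eq_single i]
  · simp
  · intro j _ hj; simp [hj]
  · simp

/-- Inserting ∑ S_j S_j* = 1 to the right of U gives one direction; multiplying the fixed point
equation by S_i on the right gives the other. -/
theorem mem_intertwiners_iff (hS : IsCuntzFamily S) (U : E →L[ℂ] E') :
    U ∈ intertwiners S T ↔ transferMap S T U = U := by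
  constructor
  · intro h
    ext x
    rw [transferMap_apply]
    conv_rhs => rw [← hS.sum_apply_star_apply x, map_sum]
    rw [sum_apply]
    refine Finset.sum_congr rfl fun j _ => ?_
    have := congrArg (fun A : E →L[ℂ] E' => A (star (S j) x)) (h j)
    exact this.symm
  · intro h i
    conv_lhs => rw [← h]
    exact transferMap_comp_apply hS U i

/-- Multiplying U = ∑ T_j U S_j* by T_i* on the left: the adjoints are intertwined automatically, so
no separate condition on them is needed. -/
theorem intertwiners.comp_star (hS : IsCuntzFamily S) (hT : IsCuntzFamily T) {U : E →L[ℂ] E'}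
    (hU : U ∈ intertwiners S T) (i : Fin N) : U ∘L star (S i) = star (T i) ∘L U := by
  ext x
  have h : star (T i) (transferMap S T U x) = U (star (S i) x) := by
    simp only [transferMap_apply, ContinuousLinearMap.comp_apply, sum_apply, map_sum,
      hT.star_apply_apply]
    rw [Finset.sum_eq_single i]
    · simp
    · intro j _ hj; simp [hj.symm]
    · simp
  rw [(mem_intertwiners_iff hS U).1 hU] at h
  exact h.symm

theorem commutant_eq_intertwiners (hS : IsCuntzFamily S) : commutant S = intertwiners S S := by
  ext X
  change X ∈ StarSubalgebra.centralizer ℂ (Set.range S) ↔ _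
  rw [StarSubalgebra.mem_centralizer_iff]
  constructor
  · intro h i
    exact (h (S i) ⟨i, rfl⟩).1.symm
  · rintro h _ ⟨i, rfl⟩
    exact ⟨(h i).symm, (intertwiners.comp_star hS hS h i).symm⟩

/-- The vectors which all words of length `n` in the `Sⱼ*` map into `K`. -/
def absorbed (S : Fin N → E →L[ℂ] E) (K : Submodule ℂ E) : ℕ → Submodule ℂ E
  | 0 => K
  | n + 1 => ⨅ j, (absorbed S K n).comap (star (S j)).toLinearMap

theorem mem_absorbed_succ {K : Submodule ℂ E} {n : ℕ} {x : E} :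
    x ∈ absorbed S K (n + 1) ↔ ∀ j, star (S j) x ∈ absorbed S K n := by
  simp [absorbed]

theorem absorbed_mono {K : Submodule ℂ E} (hK : ∀ j, ∀ x ∈ K, star (S j) x ∈ K) :
    Monotone (absorbed S K) := by
  refine monotone_nat_of_le_succ fun n => ?_
  induction n with
  | zero => exact fun x hx => mem_absorbed_succ.2 fun j => hK j x hx
  | succ n ih => exact fun x hx => mem_absorbed_succ.2 fun j => ih (mem_absorbed_succ.1 hx j)

/-- `K` is invariant under the `Sⱼ*`, which restrict to the `Vⱼ*`, and every vector is a limit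
of vectors which are mapped into `K` by all sufficiently long words in the `Sⱼ*`. -/
structure IsCore (S : Fin N → E →L[ℂ] E) (K : Submodule ℂ E) [CompleteSpace K]
    (V : Fin N → K →L[ℂ] K) : Prop where
  cuntz : IsCuntzFamily S
  coe_star_apply : ∀ j (k : K), (star (V j) k : E) = star (S j) k
  dense : Dense (⋃ n, (absorbed S K n : Set E))

namespace IsCore

variable {K : Submodule ℂ E} [CompleteSpace K] {V : Fin N → K →L[ℂ] K}
  {K' : Submodule ℂ E'} [CompleteSpace K'] {W : Fin N → K' →L[ℂ] K'}

theorem star_mem (hV : IsCore S K V) (j : Fin N) {x : E} (hx : x ∈ K) : star (S j) x ∈ K := by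
  rw [← hV.coe_star_apply j ⟨x, hx⟩]
  exact Subtype.coe_prop _

theorem absorbed_mono (hV : IsCore S K V) : Monotone (absorbed S K) :=
  _root_.absorbed_mono fun j _ hx => hV.star_mem j hx

/-- The absorbed subspaces increase, so two absorbed vectors can be taken at a common level n;
density and closedness do the rest. -/
theorem forall_of_forall_absorbed (hV : IsCore S K V) (hW : IsCore T K' W) {p : E → E' → Prop}
    (hp : ∀ n, ∀ x ∈ absorbed S K n, ∀ y ∈ absorbed T K' n, p x y)
    (hcl : IsClosed {q : E × E' | p q.1 q.2}) (x : E) (y : E') : p x y := by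
  have hd : Dense ((⋃ n, (absorbed S K n : Set E)) ×ˢ (⋃ n, (absorbed T K' n : Set E'))) :=
    hV.dense.prod hW.dense
  refine hcl.closure_subset_iff.2 ?_ (hd (x, y))
  rintro ⟨x, y⟩ ⟨hx, hy⟩
  obtain ⟨n, hn⟩ := Set.mem_iUnion.1 hx
  obtain ⟨m, hm⟩ := Set.mem_iUnion.1 hy
  exact hp (max n m) x (hV.absorbed_mono (le_max_left n m) hn) y
    (hW.absorbed_mono (le_max_right n m) hm)

theorem inner_compress_apply (U : E →L[ℂ] E') (x : K) (y : K') :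
    ⟪y, compress K K' U x⟫_ℂ = ⟪(y : E'), U x⟫_ℂ := by
  rw [Submodule.coe_inner]
  exact Submodule.inner_starProjection_left_eq_right K' _ _ |>.symm.trans (by
    rw [Submodule.starProjection_eq_self_iff.2 y.2]; rfl)

theorem norm_compress_le (U : E →L[ℂ] E') : ‖compress K K' U‖ ≤ ‖U‖ := by
  refine norm_le_of_norm_inner_le _ (norm_nonneg _) fun x y => ?_
  rw [inner_compress_apply]
  refine (norm_inner_le_norm _ _).trans ?_
  rw [mul_comm]
  exact mul_le_mul_of_nonneg_right (U.le_opNorm _) (norm_nonneg _)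

/-- Each coefficient of the transferred operator evaluates U at S_j* x and T_j* y, which stay in the
cores and are given there by V_j* and W_j*. -/
theorem compress_transferMap (hV : IsCore S K V) (hW : IsCore T K' W) (U : E →L[ℂ] E') :
    compress K K' (transferMap S T U) = transferMap V W (compress K K' U) := by
  ext1 x
  refine ext_inner_left ℂ fun y => ?_
  rw [inner_compress_apply, inner_transferMap_apply, inner_transferMap_apply]
  refine Finset.sum_congr rfl fun j _ => ?_
  rw [inner_compress_apply, hV.coe_star_apply, hW.coe_star_apply]

/-- The central estimate: n steps bring both vectors into the cores, where only the compression of U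
is seen, and each step preserves the constant. -/
theorem norm_inner_transferMap_pow_le (hV : IsCore S K V) (hW : IsCore T K' W) (U : E →L[ℂ] E')
    (n : ℕ) : ∀ x ∈ absorbed S K n, ∀ y ∈ absorbed T K' n,
      ‖⟪y, (transferMap S T ^ n) U x⟫_ℂ‖ ≤ ‖compress K K' U‖ * ‖x‖ * ‖y‖ := by
  induction n with
  | zero =>
    intro x hx y hy
    have h := inner_compress_apply U (⟨x, hx⟩ : K) (⟨y, hy⟩ : K')
    refine (le_of_eq (congrArg norm h.symm)).trans ((norm_inner_le_norm _ _).trans ?_)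
    rw [mul_comm]
    exact mul_le_mul_of_nonneg_right ((compress K K' U).le_opNorm _) (norm_nonneg _)
  | succ n ih =>
    intro x hx y hy
    rw [pow_succ']
    refine norm_inner_transferMap_le hV.cuntz hW.cuntz _
      (ContinuousLinearMap.opNorm_nonneg _) x y fun j => ?_
    exact ih _ (mem_absorbed_succ.1 hx j) _ (mem_absorbed_succ.1 hy j)

/-- A fixed point equals all its iterates, so the central estimate applies to it at every level. -/
theorem norm_eq_norm_compress (hV : IsCore S K V) (hW : IsCore T K' W) {U : E →L[ℂ] E'}
    (hU : transferMap S T U = U) : ‖compress K K' U‖ = ‖U‖ := by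
  refine le_antisymm (norm_compress_le U) 
    (norm_le_of_norm_inner_le _ (ContinuousLinearMap.opNorm_nonneg _) ?_)
  have hn : ∀ n, (transferMap S T ^ n) U = U := by
    intro n
    induction n with
    | zero => rfl
    | succ n ih => rw [pow_succ]; change (transferMap S T ^ n) (transferMap S T U) = U; rw [hU, ih]
  refine hV.forall_of_forall_absorbed hW (fun n x hx y hy => ?_) ?_
  · rw [← congrArg (fun A : E →L[ℂ] E' => A x) (hn n)]
    exact hV.norm_inner_transferMap_pow_le hW U n x hx y hy
  · exact isClosed_le (by fun_prop) (by fun_prop)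

/-- An operator that is `n` times iterated from operators with vanishing compression is zero. -/
theorem eq_zero_of_forall_compress_eq_zero (hV : IsCore S K V) (hW : IsCore T K' W)
    {U : E →L[ℂ] E'}
    (h : ∀ n, ∃ U' : E →L[ℂ] E', (transferMap S T ^ n) U' = U ∧ compress K K' U' = 0) :
    U = 0 := by
  ext1 x
  refine ext_inner_left ℂ fun y => ?_
  rw [zero_apply, inner_zero_right]
  refine hV.forall_of_forall_absorbed hW (p := fun x y => ⟪y, U x⟫_ℂ = 0) (fun n x hx y hy => ?_) ?_
    x y
  · obtain ⟨U', rfl, h0⟩ := h n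
    have := hV.norm_inner_transferMap_pow_le hW U' n x hx y hy
    rw [h0, ContinuousLinearMap.opNorm_zero, zero_mul, zero_mul, norm_le_zero_iff] at this
    exact this
  · exact isClosed_eq (by fun_prop) continuous_const

theorem exists_compress_eq (hV : IsCore S K V) (hW : IsCore T K' W) {A : K →L[ℂ] K'}
    (hA : transferMap V W A = A) :
    ∃ U : E →L[ℂ] E', transferMap S T U = U ∧ compress K K' U = A := by
  -- Extension of A by zero off K. Any operator with compression A would serve.
  set A' : E →L[ℂ] E' := K'.subtypeL ∘L A ∘L K.orthogonalProjectionOnto with hA'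
  have hc : compress K K' A' = A := by
    ext1 x
    simp [compress, hA']
  set U : ℕ → E →L[ℂ] E' := fun n => (transferMap S T ^ n) A' with hU
  have hsucc : ∀ n, U (n + 1) = transferMap S T (U n) := fun n => by
    simp only [hU, pow_succ']; rfl
  have hUc : ∀ n, compress K K' (U n) = A := by
    intro n
    induction n with
    | zero => exact hc
    | succ n ih => rw [hsucc, hV.compress_transferMap hW, ih, hA]
  -- The ultrafilter limit supplies a bounded operator at once; its values are needed only between
  -- absorbed vectors, where the sequence is eventually constant.
  obtain ⟨B, hB⟩ := exists_weak_limit (Filter.hyperfilter ℕ) U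
    (fun n => norm_transferMap_pow_le hV.cuntz hW.cuntz n A')
  -- U (n + 1) − U n is the n-th iterate of Σ(A') − A', whose compression σ(A) − A vanishes.
  have hstep : ∀ n, ∀ x ∈ absorbed S K n, ∀ y ∈ absorbed T K' n,
      ⟪y, U (n + 1) x⟫_ℂ = ⟪y, U n x⟫_ℂ := by
    intro n x hx y hy
    have h1 : U (n + 1) - U n = (transferMap S T ^ n) (transferMap S T A' - A') := by
      rw [map_sub, hU]; simp only [pow_succ]; rfl
    have h2 := hV.norm_inner_transferMap_pow_le hW (transferMap S T A' - A') n x hx y hy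
    have h3 : compress K K' (transferMap S T A' - A') = 0 := by
      have : compress K K' (transferMap S T A' - A') =
        compress K K' (transferMap S T A') - compress K K' A' := by
        simp [compress, ContinuousLinearMap.sub_comp, ContinuousLinearMap.comp_sub]
      rw [this, hV.compress_transferMap hW, hc, hA, sub_self]
    rw [h3, ← h1, ContinuousLinearMap.opNorm_zero, zero_mul, zero_mul, norm_le_zero_iff, sub_apply,
      inner_sub_right, sub_eq_zero] at h2
    exact h2
  have hconst : ∀ n, ∀ x ∈ absorbed S K n, ∀ y ∈ absorbed T K' n, ∀ m, n ≤ m →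
      ⟪y, U m x⟫_ℂ = ⟪y, U n x⟫_ℂ := by
    intro n x hx y hy m hm
    induction m, hm using Nat.le_induction with
    | base => rfl
    | succ m hm ih =>
      rw [hstep m x (hV.absorbed_mono hm hx) y (hW.absorbed_mono hm hy), ih]
  have hval : ∀ n, ∀ x ∈ absorbed S K n, ∀ y ∈ absorbed T K' n, ⟪y, B x⟫_ℂ = ⟪y, U n x⟫_ℂ := by
    intro n x hx y hy
    refine tendsto_nhds_unique (hB x y) (Filter.Tendsto.mono_left ?_ Nat.hyperfilter_le_atTop)
    refine tendsto_const_nhds.congr' ?_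
    filter_upwards [Filter.eventually_ge_atTop n] with m hm
    exact (hconst n x hx y hy m hm).symm
  refine ⟨B, ?_, ?_⟩
  · ext1 x
    refine ext_inner_left ℂ fun y => ?_
    refine hV.forall_of_forall_absorbed hW (p := fun x y => ⟪y, transferMap S T B x⟫_ℂ = ⟪y, B x⟫_ℂ)
      (fun n x hx y hy => ?_) (isClosed_eq (by fun_prop) (by fun_prop)) x y
    -- One level is spent on applying the transfer map to B, so x and y are regarded at level n + 1.
    have hx' := hV.absorbed_mono n.le_succ hx
    have hy' := hW.absorbed_mono n.le_succ hy
    rw [inner_transferMap_apply, hval _ x hx' y hy', hsucc, inner_transferMap_apply]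
    refine Finset.sum_congr rfl fun j _ => ?_
    exact hval n _ (mem_absorbed_succ.1 hx' j) _ (mem_absorbed_succ.1 hy' j)
  · ext1 x
    refine ext_inner_left ℂ fun y => ?_
    rw [inner_compress_apply, hval 0 x x.2 y y.2, ← hUc 0, inner_compress_apply]

/-- Compression is an isometric isomorphism from the intertwiners onto the fixed points. -/
theorem exists_compressEquiv (hV : IsCore S K V) (hW : IsCore T K' W) :
    ∃ Ψ : intertwiners S T ≃ₗᵢ[ℂ] transferFixedPoints V W,
      ∀ U, (Ψ U : K →L[ℂ] K') = compress K K' (U : E →L[ℂ] E') := by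
  let f : intertwiners S T →ₗ[ℂ] transferFixedPoints V W :=
    { toFun := fun U => ⟨compress K K' U, by
        change transferMap V W (compress K K' U) = _
        rw [← hV.compress_transferMap hW, (mem_intertwiners_iff hV.cuntz _).1 U.2]⟩
      map_add' := fun U U' => Subtype.ext (by
        simp [compress, ContinuousLinearMap.add_comp, ContinuousLinearMap.comp_add])
      map_smul' := fun c U => Subtype.ext (by
        simp [compress, ContinuousLinearMap.smul_comp]) }
  let g : intertwiners S T →ₗᵢ[ℂ] transferFixedPoints V W :=
    { f with
      norm_map' := fun U => hV.norm_eq_norm_compress hW ((mem_intertwiners_iff hV.cuntz _).1 U.2) }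
  have hg : Function.Surjective g := by
    rintro ⟨A, hA⟩
    obtain ⟨U, hU, hUA⟩ := hV.exists_compress_eq hW hA
    exact ⟨⟨U, (mem_intertwiners_iff hV.cuntz _).2 hU⟩, Subtype.ext hUA⟩
  exact ⟨LinearIsometryEquiv.ofSurjective g hg, fun U => rfl⟩

open scoped ComplexOrder in
theorem inner_transferMap_pow_nonneg (X : E →L[ℂ] E) (hX : 0 ≤ compress K K X) (n : ℕ) :
    ∀ x ∈ absorbed S K n, 0 ≤ ⟪x, (transferMap S S ^ n) X x⟫_ℂ := by
  induction n with
  | zero =>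
    intro x hx
    have h := inner_compress_apply X (⟨x, hx⟩ : K) (⟨x, hx⟩ : K)
    refine (ContinuousLinearMap.IsPositive.inner_nonneg_right
      ((ContinuousLinearMap.nonneg_iff_isPositive _).1 hX) (⟨x, hx⟩ : K)).trans (le_of_eq h)
  | succ n ih =>
    intro x hx
    rw [pow_succ']
    refine le_of_le_of_eq ?_ (inner_transferMap_apply S S ((transferMap S S ^ n) X) x x).symm
    exact Finset.sum_nonneg fun j _ => ih _ (mem_absorbed_succ.1 hx j)

-- Positivity of the quadratic form passes from K to absorbed vectors, since ⟪x, Σ(X) x⟫ is a sum of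
-- values ⟪S_j* x, X S_j* x⟫, and then to all vectors by density.
open scoped ComplexOrder in
theorem nonneg_iff_compress_nonneg (hV : IsCore S K V) {X : E →L[ℂ] E}
    (hX : transferMap S S X = X) : 0 ≤ X ↔ 0 ≤ compress K K X := by
  constructor
  · intro h
    rw [ContinuousLinearMap.nonneg_iff_isPositive] at h ⊢
    exact h.orthogonalProjectionOnto_comp K
  · intro h
    have hn : ∀ n, (transferMap S S ^ n) X = X := by
      intro n
      induction n with
      | zero => rfl
      | succ n ih => rw [pow_succ]; change (transferMap S S ^ n) (transferMap S S X) = X; rw [hX, ih]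
    rw [ContinuousLinearMap.nonneg_iff_isPositive, ContinuousLinearMap.isPositive_iff_complex]
    have hx : ∀ x, 0 ≤ ⟪x, X x⟫_ℂ := by
      intro x
      have hcl : IsClosed {x : E | 0 ≤ ⟪x, X x⟫_ℂ} := isClosed_le continuous_const (by fun_prop)
      refine hcl.closure_subset_iff.2 ?_ (hV.dense x)
      intro x hx
      obtain ⟨n, hn'⟩ := Set.mem_iUnion.1 hx
      have := inner_transferMap_pow_nonneg X h n x hn'
      rwa [hn n] at this
    intro x
    have h1 : 0 ≤ ⟪X x, x⟫_ℂ := by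
      rw [← inner_conj_symm]
      exact star_nonneg_iff.2 (hx x)
    obtain ⟨h2, h3⟩ := Complex.nonneg_iff.1 h1
    exact ⟨Complex.ext rfl h3, h2⟩

end IsCore

end CuntzLifting

/-! ### Closed invariant subspaces -/

section InvariantSubspaces

variable {E : Type*} [NormedAddCommGroup E] [InnerProductSpace ℂ E] [CompleteSpace E]

theorem IsClosedInvariant.hasOrthogonalProjection {𝒜 : Set (E →L[ℂ] E)} {W : Submodule ℂ E}
    (h : IsClosedInvariant 𝒜 W) : W.HasOrthogonalProjection :=
  have : CompleteSpace W := h.1.completeSpace_coe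
  inferInstance

/-- For a self-adjoint family the orthogonal complement is invariant as well, so the projection
commutes with the family. -/
theorem IsClosedInvariant.apply_starProjection {𝒜 : Set (E →L[ℂ] E)} {W : Submodule ℂ E}
    [W.HasOrthogonalProjection] (h𝒜 : ∀ A ∈ 𝒜, star A ∈ 𝒜) (h : IsClosedInvariant 𝒜 W)
    {A : E →L[ℂ] E} (hA : A ∈ 𝒜) (x : E) : W.starProjection (A x) = A (W.starProjection x) := by
  refine Submodule.eq_starProjection_of_mem_of_inner_eq_zero
    (h.2 A hA _ (W.starProjection_apply_mem x)) fun w hw => ?_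
  rw [← map_sub, ← star_star A, star_apply_inner_left]
  exact Submodule.starProjection_inner_eq_zero _ _ (h.2 _ (h𝒜 A hA) w hw)

theorem isClosedInvariant_eigenspace {𝒜 : Set (E →L[ℂ] E)} (X : E →L[ℂ] E)
    (h : ∀ A ∈ 𝒜, A * X = X * A) (c : ℂ) :
    IsClosedInvariant 𝒜 (Module.End.eigenspace (X : E →ₗ[ℂ] E) c) := by
  constructor
  · have : (Module.End.eigenspace (X : E →ₗ[ℂ] E) c : Set E) = {x | X x = c • x} := by
      ext x; exact Module.End.mem_eigenspace_iff
    rw [this]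
    exact isClosed_eq (by fun_prop) (by fun_prop)
  · intro A hA x hx
    rw [Module.End.mem_eigenspace_iff] at hx ⊢
    have h1 := congrArg (fun B : E →L[ℂ] E => B x) (h A hA)
    change X x = c • x at hx
    change A (X x) = X (A x) at h1
    change X (A x) = c • A x
    rw [← h1, hx, map_smul]

end InvariantSubspaces

/-! ### Schur's lemma and the irreducibility criterion -/

section Schur

variable {N : ℕ} {E : Type*} [NormedAddCommGroup E] [InnerProductSpace ℂ E] [CompleteSpace E]
  {S : Fin N → E →L[ℂ] E} {K : Submodule ℂ E} [CompleteSpace K] {V : Fin N → K →L[ℂ] K}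

theorem star_mem_cuntzAlgebra (S : Fin N → E →L[ℂ] E) :
    ∀ A ∈ cuntzAlgebra S, star A ∈ cuntzAlgebra S :=
  fun _ hA => (StarAlgebra.adjoin ℂ (Set.range S)).topologicalClosure.star_mem' hA

theorem mem_cuntzAlgebra (S : Fin N → E →L[ℂ] E) (j : Fin N) : S j ∈ cuntzAlgebra S :=
  StarSubalgebra.le_topologicalClosure _ (StarAlgebra.subset_adjoin ℂ _ ⟨j, rfl⟩)

theorem commute_of_mem_cuntzAlgebra (hS : IsCuntzFamily S) {X : E →L[ℂ] E}
    (hX : X ∈ intertwiners S S) : ∀ A ∈ cuntzAlgebra S, A * X = X * A := by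
  have hX' : star X ∈ intertwiners S S := fun i => by
    have := congrArg star (intertwiners.comp_star hS hS hX i)
    change star (X * star (S i)) = star (star (S i) * X) at this
    rw [star_mul, star_mul, star_star] at this
    exact this.symm
  have hle : StarAlgebra.adjoin ℂ (Set.range S) ≤ StarSubalgebra.centralizer ℂ {X} := by
    refine StarAlgebra.adjoin_le ?_
    rintro _ ⟨i, rfl⟩
    refine StarSubalgebra.mem_centralizer_iff ℂ |>.2 ?_
    rintro _ rfl
    exact ⟨hX i, hX' i⟩
  intro A hA
  have hcl : IsClosed {A : E →L[ℂ] E | A * X = X * A} := isClosed_eq (by fun_prop) (by fun_prop)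
  refine hcl.closure_subset_iff.2 ?_ hA
  intro B hB
  exact ((StarSubalgebra.mem_centralizer_iff ℂ).1 (hle hB) X rfl).1.symm

theorem one_mem_intertwiners (S : Fin N → E →L[ℂ] E) : (1 : E →L[ℂ] E) ∈ intertwiners S S :=
  fun _ => rfl

theorem mul_mem_intertwiners {X Y : E →L[ℂ] E} (hX : X ∈ intertwiners S S)
    (hY : Y ∈ intertwiners S S) : X * Y ∈ intertwiners S S := fun i => by
  change X * Y * S i = S i * (X * Y)
  have h1 : X * S i = S i * X := hX i
  have h2 : Y * S i = S i * Y := hY i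
  rw [mul_assoc, h2, ← mul_assoc, h1, mul_assoc]

namespace IsCore

theorem finiteDimensional_intertwiners [FiniteDimensional ℂ K] (hV : IsCore S K V) :
    FiniteDimensional ℂ (intertwiners S S) := by
  obtain ⟨Ψ, -⟩ := hV.exists_compressEquiv hV
  exact LinearEquiv.finiteDimensional Ψ.toLinearEquiv.symm

theorem exists_smul_one_of_irreducible [FiniteDimensional ℂ K] (hV : IsCore S K V)
    (hirr : IsIrreducibleRep S) {X : E →L[ℂ] E} (hX : X ∈ intertwiners S S) :
    ∃ c : ℂ, X = c • 1 := by
  have := hV.finiteDimensional_intertwiners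
  have hE : Nontrivial E := by
    by_contra h
    rw [not_nontrivial_iff_subsingleton] at h
    exact hirr.1 (Subsingleton.elim _ _)
  have : Nontrivial (intertwiners S S) := by
    refine ⟨⟨⟨1, one_mem_intertwiners S⟩, 0, fun h => ?_⟩⟩
    exact one_ne_zero (congrArg Subtype.val h)
  -- Left multiplication by X acts on a nonzero finite-dimensional space. An eigenvector Y ≠ 0 has
  -- its range in an eigenspace of X, which is thus nonzero and invariant, hence everything.
  let L : Module.End ℂ (intertwiners S S) :=
    { toFun := fun Y => ⟨X * Y, mul_mem_intertwiners hX Y.2⟩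
      map_add' := fun Y Z => Subtype.ext (mul_add _ _ _)
      map_smul' := fun c Y => Subtype.ext (mul_smul_comm _ _ _) }
  obtain ⟨c, hc⟩ := Module.End.exists_eigenvalue L
  obtain ⟨Y, hY⟩ := hc.exists_hasEigenvector
  have hXY : X * (Y : E →L[ℂ] E) = c • (Y : E →L[ℂ] E) := congrArg Subtype.val hY.apply_eq_smul
  have hY0 : (Y : E →L[ℂ] E) ≠ 0 := fun h => hY.2 (Subtype.ext h)
  refine ⟨c, ?_⟩
  have hinv := isClosedInvariant_eigenspace X (commute_of_mem_cuntzAlgebra hV.cuntz hX) c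
  rcases hirr.2.2 _ hinv le_top with h | h
  · refine absurd ?_ hY0
    ext x
    have : (Y : E →L[ℂ] E) x ∈ Module.End.eigenspace (X : E →ₗ[ℂ] E) c :=
      Module.End.mem_eigenspace_iff.2 (congrArg (fun A : E →L[ℂ] E => A x) hXY)
    rw [h] at this
    exact (Submodule.mem_bot ℂ).1 this
  · ext x
    exact Module.End.mem_eigenspace_iff.1 (h ▸ Submodule.mem_top : x ∈ _)

theorem compress_one : compress K K (1 : E →L[ℂ] E) = 1 := by
  ext1 x
  refine ext_inner_left ℂ fun y => ?_
  rw [inner_compress_apply]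
  rfl

theorem compress_smul_one (c : ℂ) : compress K K (c • 1 : E →L[ℂ] E) = c • 1 := by
  rw [← compress_one]
  simp [compress, ContinuousLinearMap.smul_comp]

theorem isIrreducibleRep_iff [FiniteDimensional ℂ K] [Nontrivial E] (hV : IsCore S K V) :
    IsIrreducibleRep S ↔ transferFixedPoints V V = Submodule.span ℂ {1} := by
  obtain ⟨Ψ, hΨ⟩ := hV.exists_compressEquiv hV
  have hone : (Ψ ⟨1, one_mem_intertwiners S⟩ : K →L[ℂ] K) = 1 := by
    rw [hΨ]; exact compress_one
  constructor
  · intro hirr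
    refine le_antisymm (fun A hA => ?_) ?_
    · obtain ⟨U, hU⟩ := Ψ.surjective ⟨A, hA⟩
      obtain ⟨c, hc⟩ := hV.exists_smul_one_of_irreducible hirr U.2
      have h := hΨ U
      rw [hU, hc, compress_smul_one] at h
      exact Submodule.mem_span_singleton.2 ⟨c, h.symm⟩
    · rw [Submodule.span_singleton_le_iff_mem, ← hone]
      exact Subtype.coe_prop _
  · intro hfix
    refine ⟨bot_ne_top.symm, ⟨isClosed_univ, fun _ _ _ _ => trivial⟩, fun U hU _ => ?_⟩
    -- The projection onto an invariant subspace is an intertwiner; its compression is scalar, so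
    -- injectivity of compression makes the projection scalar.
    have := hU.hasOrthogonalProjection
    have hP : U.starProjection ∈ intertwiners S S := fun i => by
      ext x
      exact hU.apply_starProjection (star_mem_cuntzAlgebra S) (mem_cuntzAlgebra S i) x
    have hc : (Ψ ⟨_, hP⟩ : K →L[ℂ] K) ∈ Submodule.span ℂ {(1 : K →L[ℂ] K)} := by
      rw [← hfix]; exact Subtype.coe_prop _
    obtain ⟨c, hc⟩ := Submodule.mem_span_singleton.1 hc
    have hPc : (⟨_, hP⟩ : intertwiners S S) = c • ⟨1, one_mem_intertwiners S⟩ := by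
      apply Ψ.injective
      rw [map_smul]
      refine Subtype.ext ?_
      rw [← hc, ← hone]
      rfl
    have hPc' : ∀ x, U.starProjection x = c • x := fun x =>
      congrArg (fun A : intertwiners S S => (A : E →L[ℂ] E) x) hPc
    by_cases h0 : U = ⊥
    · exact Or.inl h0
    · right
      obtain ⟨x, hx, hx0⟩ := (Submodule.ne_bot_iff U).1 h0
      have hc1 : c = 1 := by
        have h := hPc' x
        rw [Submodule.starProjection_eq_self_iff.2 hx] at h
        exact (smul_left_injective ℂ hx0 (by simpa using h)).symm
      refine eq_top_iff.2 fun y _ => ?_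
      rw [← Submodule.starProjection_eq_self_iff, hPc', hc1, one_smul]

end IsCore

end Schur

/-! ### Unimodular eigenvalues of the transfer map -/

section PeripheralGroup

variable {N : ℕ} {E : Type*} [NormedAddCommGroup E] [InnerProductSpace ℂ E] [CompleteSpace E]
  {S : Fin N → E →L[ℂ] E} {K : Submodule ℂ E} [CompleteSpace K] {V : Fin N → K →L[ℂ] K}

theorem transferMap_self_apply (S : Fin N → E →L[ℂ] E) (U : E →L[ℂ] E) :
    transferMap S S U = ∑ j, S j * U * star (S j) := by
  rw [transferMap_apply]
  rfl

/-- With its converse `IsCuntzFamily.transferMap_eq_smul`, this turns the eigenvalue equation into a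
twisted commutation relation, which is visibly multiplicative in U and c. -/
theorem IsCuntzFamily.smul_mul_eq (hS : IsCuntzFamily S) {U : E →L[ℂ] E} {c : ℂ}
    (hU : transferMap S S U = c • U) (j : Fin N) : c • (U * S j) = S j * U := by
  have h : transferMap S S U * S j = S j * U := transferMap_comp_apply hS U j
  rw [← h, hU, smul_mul_assoc]

theorem IsCuntzFamily.transferMap_eq_smul (hS : IsCuntzFamily S) {U : E →L[ℂ] E} {c : ℂ}
    (hU : ∀ j, c • (U * S j) = S j * U) : transferMap S S U = c • U := by
  rw [transferMap_self_apply]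
  simp only [← hU, smul_mul_assoc, mul_assoc]
  rw [← Finset.smul_sum, ← Finset.mul_sum, hS.2, mul_one]

theorem IsCuntzFamily.transferMap_mul (hS : IsCuntzFamily S) {U U' : E →L[ℂ] E} {c c' : ℂ}
    (hU : transferMap S S U = c • U) (hU' : transferMap S S U' = c' • U') :
    transferMap S S (U * U') = (c * c') • (U * U') := by
  refine hS.transferMap_eq_smul fun j => ?_
  rw [← mul_assoc, ← hS.smul_mul_eq hU, smul_mul_assoc, mul_assoc U (S j),
    ← hS.smul_mul_eq hU', mul_smul, mul_smul_comm, mul_assoc]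

theorem IsCuntzFamily.transferMap_one (hS : IsCuntzFamily S) :
    transferMap S S (1 : E →L[ℂ] E) = 1 := by
  rw [transferMap_self_apply]
  simp only [mul_one]
  exact hS.2

theorem IsCuntzFamily.transferMap_pow (hS : IsCuntzFamily S) {U : E →L[ℂ] E} {c : ℂ}
    (hU : transferMap S S U = c • U) (n : ℕ) :
    transferMap S S (U ^ n) = (c ^ n) • (U ^ n) := by
  induction n with
  | zero => simpa using hS.transferMap_one
  | succ n ih => rw [pow_succ, pow_succ]; exact hS.transferMap_mul ih hU

theorem transferMap_star {U : E →L[ℂ] E} {c : ℂ}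
    (hU : transferMap S S U = c • U) :
    transferMap S S (star U) = (starRingEnd ℂ) c • star U := by
  have h := congrArg star hU
  rw [star_smul, transferMap_self_apply, star_sum] at h
  rw [transferMap_self_apply]
  refine Eq.trans ?_ h
  refine Finset.sum_congr rfl fun j _ => ?_
  rw [star_mul, star_mul, star_star, mul_assoc]

/-- Eigenvectors become intertwiners between the family and its rescaling, so the lifting theory for
two representations applies to them. -/
theorem transferMap_inv_smul_eq_self_iff {U : E →L[ℂ] E} {c : ℂ}
    (hc : ‖c‖ = 1) :
    transferMap S (fun j => c⁻¹ • S j) U = U ↔ transferMap S S U = c • U := by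
  have hc0 : c ≠ 0 := fun h => by simp [h] at hc
  have h : transferMap S (fun j => c⁻¹ • S j) U = c⁻¹ • transferMap S S U := by
    rw [transferMap_apply, transferMap_apply, Finset.smul_sum]
    rfl
  rw [h, inv_smul_eq_iff₀ hc0]

theorem absorbed_smul {c : ℂ} (hc : c ≠ 0) (n : ℕ) :
    absorbed (fun j => c • S j) K n = absorbed S K n := by
  induction n with
  | zero => rfl
  | succ n ih =>
    ext x
    rw [mem_absorbed_succ, mem_absorbed_succ, ih]
    refine forall_congr' fun j => ?_
    rw [star_smul]
    exact Submodule.smul_mem_iff _ (by simpa using hc)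

namespace IsCore

theorem smul (hV : IsCore S K V) {c : ℂ} (hc : ‖c‖ = 1) :
    IsCore (fun j => c • S j) K (fun j => c • V j) where
  cuntz := hV.cuntz.smul hc
  coe_star_apply j k := by
    rw [star_smul, star_smul, smul_apply, smul_apply, Submodule.coe_smul, hV.coe_star_apply]
  dense := by
    have hc0 : c ≠ 0 := fun h => by simp [h] at hc
    simp only [absorbed_smul hc0]
    exact hV.dense

theorem exists_scalar (hV : IsCore S K V) [FiniteDimensional ℂ K] (hirr : IsIrreducibleRep S)
    {X : E →L[ℂ] E} (hX : transferMap S S X = X) : ∃ c : ℂ, X = c • 1 :=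
  hV.exists_smul_one_of_irreducible hirr ((mem_intertwiners_iff hV.cuntz X).2 hX)

/-- Unimodular eigenvectors are multiples of unitaries. -/
theorem exists_star_mul_self_eq (hV : IsCore S K V) [FiniteDimensional ℂ K]
    (hirr : IsIrreducibleRep S) {U : E →L[ℂ] E} {c : ℂ} (hc : ‖c‖ = 1) (hU0 : U ≠ 0)
    (hU : transferMap S S U = c • U) :
    ∃ r : ℂ, r ≠ 0 ∧ star U * U = r • 1 ∧ U * star U = r • 1 := by
  have hs := transferMap_star hU
  have hcc : (starRingEnd ℂ) c * c = 1 := by rw [Complex.conj_mul', hc]; simp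
  obtain ⟨r, hr⟩ := hV.exists_scalar hirr (X := star U * U) (by
    rw [hV.cuntz.transferMap_mul hs hU, hcc, one_smul])
  obtain ⟨r', hr'⟩ := hV.exists_scalar hirr (X := U * star U) (by
    rw [hV.cuntz.transferMap_mul hU hs, mul_comm, hcc, one_smul])
  have h0 : r ≠ 0 := by
    rintro rfl
    rw [zero_smul, CStarRing.star_mul_self_eq_zero_iff] at hr
    exact hU0 hr
  -- Associativity of U U* U compares the two scalars.
  have hrr : r = r' := by
    have h1 : U * (star U * U) = (U * star U) * U := (mul_assoc _ _ _).symm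
    rw [hr, hr', mul_smul_comm, smul_mul_assoc, mul_one, one_mul] at h1
    exact smul_left_injective ℂ hU0 h1
  exact ⟨r, h0, hr, hrr ▸ hr'⟩

theorem mul_ne_zero_of_eigen (hV : IsCore S K V) [FiniteDimensional ℂ K]
    (hirr : IsIrreducibleRep S) {U U' : E →L[ℂ] E} {c : ℂ} (hc : ‖c‖ = 1)
    (hU0 : U ≠ 0) (hU'0 : U' ≠ 0) (hU : transferMap S S U = c • U) : U * U' ≠ 0 := by
  obtain ⟨r, hr0, hr, -⟩ := hV.exists_star_mul_self_eq hirr hc hU0 hU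
  intro h
  have h1 : star U * (U * U') = r • U' := by
    rw [← mul_assoc, hr, smul_mul_assoc, one_mul]
  rw [h, mul_zero] at h1
  exact hU'0 ((smul_eq_zero.1 h1.symm).resolve_left hr0)

/-- The unimodular eigenvalues of `X ↦ ∑ⱼ Sⱼ X Sⱼ*`. -/
def eigenGroup (hV : IsCore S K V) [FiniteDimensional ℂ K] (hirr : IsIrreducibleRep S) :
    Subgroup Circle where
  carrier := {c | ∃ U : E →L[ℂ] E, U ≠ 0 ∧ transferMap S S U = (c : ℂ) • U}
  mul_mem' := by
    rintro c c' ⟨U, hU0, hU⟩ ⟨U', hU'0, hU'⟩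
    refine ⟨U * U', hV.mul_ne_zero_of_eigen hirr (Circle.norm_coe c) hU0 hU'0 hU, ?_⟩
    rw [hV.cuntz.transferMap_mul hU hU', Circle.coe_mul]
  one_mem' := by
    refine ⟨1, fun h => hirr.1 ?_, ?_⟩
    · refine (Submodule.eq_bot_iff _).2 fun x _ => ?_
      exact congrArg (fun A : E →L[ℂ] E => A x) h
    · rw [hV.cuntz.transferMap_one, Circle.coe_one, one_smul]
  inv_mem' := by
    rintro c ⟨U, hU0, hU⟩
    refine ⟨star U, star_ne_zero.2 hU0, ?_⟩
    rw [transferMap_star hU, Circle.coe_inv_eq_conj]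

theorem mem_eigenGroup (hV : IsCore S K V) [FiniteDimensional ℂ K] (hirr : IsIrreducibleRep S)
    {c : Circle} : c ∈ hV.eigenGroup hirr ↔
      ∃ U : E →L[ℂ] E, U ≠ 0 ∧ transferMap S S U = (c : ℂ) • U := Iff.rfl

theorem norm_transferMap_core_le (hV : IsCore S K V) (A : K →L[ℂ] K) :
    ‖transferMap V V A‖ ≤ ‖A‖ := by
  set A' : E →L[ℂ] E := K.subtypeL ∘L A ∘L K.orthogonalProjectionOnto with hA'
  have hc : compress K K A' = A := by
    ext1 x
    simp [compress, hA']
  have hn : ‖A'‖ ≤ ‖A‖ := by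
    refine A'.opNorm_le_bound (ContinuousLinearMap.opNorm_nonneg _) fun x => ?_
    change ‖A (K.orthogonalProjectionOnto x)‖ ≤ _
    refine (A.le_opNorm _).trans ?_
    exact mul_le_mul_of_nonneg_left (K.norm_orthogonalProjectionOnto_apply_le x)
      (ContinuousLinearMap.opNorm_nonneg _)
  rw [← hc, ← hV.compress_transferMap hV, hc]
  exact (norm_compress_le _).trans ((norm_transferMap_le hV.cuntz hV.cuntz _).trans hn)

/-- Rescaling by c⁻¹ gives another core on the same K, and compression between these two cores is
bijective on fixed points. -/
theorem eigen_iff (hV : IsCore S K V) {c : ℂ} (hc : ‖c‖ = 1) :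
    (∃ A : K →L[ℂ] K, A ≠ 0 ∧ transferMap V V A = c • A) ↔
      ∃ U : E →L[ℂ] E, U ≠ 0 ∧ transferMap S S U = c • U := by
  have hc0 : c ≠ 0 := fun h => by simp [h] at hc
  have hc' : ‖c⁻¹‖ = 1 := by rw [norm_inv, hc, inv_one]
  have hV' := hV.smul hc'
  constructor
  · rintro ⟨A, hA0, hA⟩
    obtain ⟨U, hU, hUA⟩ := hV.exists_compress_eq hV' (A := A) (by
      have h : transferMap V (fun j => c⁻¹ • V j) A = c⁻¹ • transferMap V V A := by
        rw [transferMap_apply, transferMap_apply, Finset.smul_sum]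
        rfl
      rw [h, hA, inv_smul_smul₀ hc0])
    refine ⟨U, ?_, (transferMap_inv_smul_eq_self_iff hc).1 hU⟩
    rintro rfl
    apply hA0
    rw [← hUA]
    simp [compress]
  · rintro ⟨U, hU0, hU⟩
    refine ⟨compress K K U, fun h => hU0 ?_, ?_⟩
    · have hn := hV.norm_eq_norm_compress hV' ((transferMap_inv_smul_eq_self_iff hc).2 hU)
      rw [h, ContinuousLinearMap.opNorm_zero] at hn
      exact norm_eq_zero.1 hn.symm
    · rw [← hV.compress_transferMap hV, hU]
      simp [compress, ContinuousLinearMap.smul_comp]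

end IsCore

theorem mem_spectrum_iff_exists_eigenvector {M : Type*} [NormedAddCommGroup M] [NormedSpace ℂ M]
    [FiniteDimensional ℂ M] (a : M →L[ℂ] M) (c : ℂ) :
    c ∈ spectrum ℂ a ↔ ∃ x, x ≠ 0 ∧ a x = c • x := by
  have : CompleteSpace M := FiniteDimensional.complete ℂ M
  rw [ContinuousLinearMap.spectrum_eq, ← Module.End.hasEigenvalue_iff_mem_spectrum]
  constructor
  · intro h
    obtain ⟨x, hx⟩ := h.exists_hasEigenvector
    exact ⟨x, hx.2, hx.apply_eq_smul⟩
  · rintro ⟨x, hx0, hx⟩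
    exact Module.End.hasEigenvalue_of_hasEigenvector
      (x := x) ⟨Module.End.mem_eigenspace_iff.2 hx, hx0⟩

theorem finite_spectrum_of_finiteDimensional {M : Type*} [NormedAddCommGroup M]
    [NormedSpace ℂ M] [FiniteDimensional ℂ M] (a : M →L[ℂ] M) : (spectrum ℂ a).Finite := by
  have : CompleteSpace M := FiniteDimensional.complete ℂ M
  rw [ContinuousLinearMap.spectrum_eq]
  refine (Module.End.finite_hasEigenvalue (a : Module.End ℂ M)).subset fun c hc => ?_
  exact Module.End.hasEigenvalue_iff_mem_spectrum.2 hc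

namespace IsCore

/-- The map σ is a contraction fixing 1, so its spectral radius is 1; in finite dimension its
spectral values are eigenvalues, and the unimodular ones lift. -/
theorem peripheralSpectrum_eq (hV : IsCore S K V) [FiniteDimensional ℂ K] [Nontrivial K]
    (hirr : IsIrreducibleRep S) :
    peripheralSpectrum (transferMap V V) =
      ((↑) : Circle → ℂ) '' (hV.eigenGroup hirr : Set Circle) := by
  have hle : ∀ c ∈ spectrum ℂ (transferMap V V), ‖c‖ ≤ 1 := by
    intro c hc
    obtain ⟨A, hA0, hA⟩ := (mem_spectrum_iff_exists_eigenvector _ c).1 hc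
    have h := hV.norm_transferMap_core_le A
    rw [hA, norm_smul] at h
    have h0 : 0 < ‖A‖ := norm_pos_iff.2 hA0
    nlinarith
  have hone : (1 : ℂ) ∈ spectrum ℂ (transferMap V V) := by
    refine (mem_spectrum_iff_exists_eigenvector _ 1).2 ⟨1, one_ne_zero, ?_⟩
    rw [← compress_one, ← hV.compress_transferMap hV, hV.cuntz.transferMap_one, one_smul]
  have hrad : spectralRadius ℂ (transferMap V V) = 1 := by
    refine le_antisymm ?_ ?_
    · refine iSup₂_le fun c hc => ?_
      rw [ENNReal.coe_le_one_iff]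
      exact hle c hc
    · refine le_trans ?_ (le_iSup₂ (f := fun c (_ : c ∈ spectrum ℂ (transferMap V V)) =>
        (‖c‖₊ : ENNReal)) 1 hone)
      simp
  ext z
  have hz : ‖z‖ₑ = 1 ↔ ‖z‖ = 1 := by
    rw [← ofReal_norm, ENNReal.ofReal_eq_one]
  rw [peripheralSpectrum, Set.mem_ofPred_eq, hrad, hz, mem_spectrum_iff_exists_eigenvector]
  constructor
  · rintro ⟨h, hz1⟩
    refine ⟨⟨z, mem_sphere_zero_iff_norm.2 hz1⟩, ?_, rfl⟩
    exact (hV.eigen_iff hz1).1 h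
  · rintro ⟨c, hc, rfl⟩
    exact ⟨(hV.eigen_iff (Circle.norm_coe c)).2 hc, Circle.norm_coe c⟩

theorem finite_eigenGroup (hV : IsCore S K V) [FiniteDimensional ℂ K] [Nontrivial K]
    (hirr : IsIrreducibleRep S) : Finite (hV.eigenGroup hirr) := by
  have h : (((↑) : Circle → ℂ) '' (hV.eigenGroup hirr : Set Circle)).Finite := by
    rw [← hV.peripheralSpectrum_eq hirr]
    exact (finite_spectrum_of_finiteDimensional (transferMap V V)).subset fun _ hz => hz.1
  exact (Set.Finite.of_finite_image h Circle.coe_injective.injOn).to_subtype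

theorem isCyclic_eigenGroup (hV : IsCore S K V) [FiniteDimensional ℂ K] [Nontrivial K]
    (hirr : IsIrreducibleRep S) : IsCyclic (hV.eigenGroup hirr) := by
  have := hV.finite_eigenGroup hirr
  exact isCyclic_of_injective_ringHom (R := ℂ)
    (f := Circle.coeHom.comp (hV.eigenGroup hirr).subtype)
    (Circle.coe_injective.comp Subtype.val_injective)

end IsCore

end PeripheralGroup

/-! ### Contractions have no unimodular Jordan blocks -/

section PowerBounded

/-- The formula for the powers of a Jordan block of size two, multiplied by c so that no exponent n
− 1 occurs. -/
theorem pow_apply_of_generalized_eigenvector {M : Type*} [AddCommGroup M] [Module ℂ M]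
    {f : Module.End ℂ M} {c : ℂ} {x y : M} (hx : f x = c • x + y) (hy : f y = c • y) (n : ℕ) :
    c • (f ^ n) x = c ^ (n + 1) • x + (n * c ^ n) • y := by
  induction n with
  | zero => simp
  | succ n ih =>
    rw [pow_succ', Module.End.mul_apply, ← map_smul, ih, map_add, map_smul, map_smul, hx, hy]
    push_cast
    module

/-- A contraction has no generalized eigenvectors for unimodular eigenvalues. -/
theorem maxGenEigenspace_le_eigenspace_of_contraction {M : Type*} [NormedAddCommGroup M]
    [NormedSpace ℂ M] {f : Module.End ℂ M} (hf : ∀ x, ‖f x‖ ≤ ‖x‖) {c : ℂ} (hc : ‖c‖ = 1) :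
    f.maxGenEigenspace c ≤ f.eigenspace c := by
  have hn : ∀ n x, ‖(f ^ n) x‖ ≤ ‖x‖ := by
    intro n x
    induction n with
    | zero => simp
    | succ n ih => rw [pow_succ', Module.End.mul_apply]; exact (hf _).trans ih
  have hker : LinearMap.ker ((f - c • 1) ^ 1) = LinearMap.ker ((f - c • 1) ^ (Nat.succ 1)) := by
    refine le_antisymm (fun x hx => ?_) fun x hx => ?_
    · rw [LinearMap.mem_ker] at hx ⊢
      rw [pow_succ', Module.End.mul_apply, hx, map_zero]
    · rw [LinearMap.mem_ker] at hx ⊢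
      rw [pow_succ', Module.End.mul_apply, pow_one] at hx
      rw [pow_one]
      set y := (f - c • 1) x with hy
      have h1 : f x = c • x + y := by rw [hy]; simp
      have h2 : f y = c • y := by simpa [sub_eq_zero] using hx
      -- A nonzero y would make the powers grow linearly, while contractivity keeps them bounded.
      have hb : ∀ n : ℕ, (n : ℝ) * ‖y‖ ≤ 2 * ‖x‖ := by
        intro n
        have h3 := pow_apply_of_generalized_eigenvector h1 h2 n
        have h4 : ((n : ℂ) * c ^ n) • y = c • (f ^ n) x - c ^ (n + 1) • x := by rw [h3]; abel
        have h5 := congrArg norm h4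
        rw [norm_smul, norm_mul, norm_pow, hc, one_pow, mul_one, Complex.norm_natCast] at h5
        rw [h5]
        refine (norm_sub_le _ _).trans ?_
        rw [norm_smul, norm_smul, norm_pow, hc, one_pow, one_mul, one_mul, two_mul]
        exact add_le_add_left (hn n x) _
      by_contra hy0
      have hpos : 0 < ‖y‖ := norm_pos_iff.2 hy0
      obtain ⟨n, hn'⟩ := exists_nat_gt (2 * ‖x‖ / ‖y‖)
      rw [div_lt_iff₀ hpos] at hn'
      exact absurd (hb n) (not_le.2 hn')
  intro x hx
  obtain ⟨n, hn'⟩ := (Module.End.mem_maxGenEigenspace f c x).1 hx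
  have h := Module.End.ker_pow_constant hker n
  have hx1 : x ∈ LinearMap.ker ((f - c • 1) ^ (1 + n)) := by
    rw [LinearMap.mem_ker, pow_add, Module.End.mul_apply, hn', map_zero]
  rw [← h, LinearMap.mem_ker, pow_one] at hx1
  rw [Module.End.mem_eigenspace_iff]
  simpa [sub_eq_zero] using hx1

end PowerBounded

/-! ### The commutant of UHF_N and its decomposition -/

section UHF

variable {N : ℕ} {E : Type*} [NormedAddCommGroup E] [InnerProductSpace ℂ E] [CompleteSpace E]
  {S : Fin N → E →L[ℂ] E} {K : Submodule ℂ E} [CompleteSpace K] {V : Fin N → K →L[ℂ] K}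

theorem cuntzWord_cons (S : Fin N → E →L[ℂ] E) (i : Fin N) (I : List (Fin N)) :
    cuntzWord S (i :: I) = S i * cuntzWord S I := by
  simp [cuntzWord]

theorem mem_uhfAlgebra (S : Fin N → E →L[ℂ] E) {I J : List (Fin N)} (h : I.length = J.length) :
    cuntzWord S I * star (cuntzWord S J) ∈ uhfAlgebra S :=
  Submodule.le_topologicalClosure _ (Submodule.subset_span ⟨I, J, h, rfl⟩)

theorem star_mem_uhfAlgebra (S : Fin N → E →L[ℂ] E) : ∀ A ∈ uhfAlgebra S, star A ∈ uhfAlgebra S := by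
  intro A hA
  refine map_mem_closure continuous_star hA fun B hB => ?_
  induction hB using Submodule.span_induction with
  | mem B hB =>
    obtain ⟨I, J, hIJ, rfl⟩ := hB
    rw [star_mul, star_star]
    exact Submodule.subset_span ⟨J, I, hIJ.symm, rfl⟩
  | zero => simp
  | add B C _ _ hB hC => rw [star_add]; exact Submodule.add_mem _ hB hC
  | smul c B _ hB => rw [star_smul]; exact Submodule.smul_mem _ _ hB

/-- The commutant of the image of `UHF_N`. -/
def uhfCommutant (S : Fin N → E →L[ℂ] E) : Submodule ℂ (E →L[ℂ] E) where
  carrier := {X | ∀ I J : List (Fin N), I.length = J.length →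
    cuntzWord S I * star (cuntzWord S J) * X = X * (cuntzWord S I * star (cuntzWord S J))}
  add_mem' := fun ha hb I J h => by rw [mul_add, add_mul, ha I J h, hb I J h]
  zero_mem' := fun I J _ => by rw [mul_zero, zero_mul]
  smul_mem' := fun c a ha I J h => by rw [mul_smul_comm, smul_mul_assoc, ha I J h]

theorem mem_uhfCommutant_of_commute {X : E →L[ℂ] E} (h : ∀ A ∈ uhfAlgebra S, A * X = X * A) :
    X ∈ uhfCommutant S :=
  fun _ _ hIJ => h _ (mem_uhfAlgebra S hIJ)

theorem commute_of_mem_uhfCommutant {X : E →L[ℂ] E} (hX : X ∈ uhfCommutant S) :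
    ∀ A ∈ uhfAlgebra S, A * X = X * A := by
  intro A hA
  have hcl : IsClosed {A : E →L[ℂ] E | A * X = X * A} := isClosed_eq (by fun_prop) (by fun_prop)
  refine hcl.closure_subset_iff.2 (fun B hB => ?_) hA
  change B * X = X * B
  induction hB using Submodule.span_induction with
  | mem B hB =>
    obtain ⟨I, J, hIJ, rfl⟩ := hB
    exact hX I J hIJ
  | zero => simp
  | add B C _ _ hB hC => rw [add_mul, mul_add, hB, hC]
  | smul c B _ hB => rw [smul_mul_assoc, mul_smul_comm, hB]

theorem transferMap_mem_uhfCommutant (hS : IsCuntzFamily S) {X : E →L[ℂ] E}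
    (hX : X ∈ uhfCommutant S) : transferMap S S X ∈ uhfCommutant S := by
  have h1 : ∀ i, transferMap S S X * S i = S i * X := fun i => transferMap_comp_apply hS X i
  have h2 : ∀ i, star (S i) * transferMap S S X = X * star (S i) := by
    intro i
    rw [transferMap_self_apply, Finset.mul_sum, Finset.sum_eq_single i]
    · rw [← mul_assoc, ← mul_assoc, hS.1, if_pos rfl, one_mul]
    · intro j _ hj
      rw [← mul_assoc, ← mul_assoc, hS.1, if_neg hj.symm, zero_mul, zero_mul]
    · simp
  rintro (_ | ⟨i, I⟩) (_ | ⟨j, J⟩) hIJ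
  · simp [cuntzWord]
  · simp at hIJ
  · simp at hIJ
  · have hIJ' : I.length = J.length := by simpa using hIJ
    rw [cuntzWord_cons, cuntzWord_cons, star_mul]
    calc S i * cuntzWord S I * (star (cuntzWord S J) * star (S j)) * transferMap S S X
        = S i * (cuntzWord S I * star (cuntzWord S J)) * (star (S j) * transferMap S S X) := by
          simp only [mul_assoc]
      _ = S i * (cuntzWord S I * star (cuntzWord S J) * X) * star (S j) := by
          rw [h2]; simp only [mul_assoc]
      _ = (S i * X) * (cuntzWord S I * star (cuntzWord S J)) * star (S j) := by
          rw [hX I J hIJ']; simp only [mul_assoc]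
      _ = _ := by rw [← h1]; simp only [mul_assoc]

/-- X commutes with each S_j S_i*, so S_j (S_i* X S_i) S_j* = X S_j S_j*, and these sum to X.
Surjectivity of the transfer map on the commutant, with a contractive inverse, follows. -/
theorem exists_transferMap_eq (hS : IsCuntzFamily S) (i : Fin N) {X : E →L[ℂ] E}
    (hX : X ∈ uhfCommutant S) :
    star (S i) * X * S i ∈ uhfCommutant S ∧ transferMap S S (star (S i) * X * S i) = X := by
  have hii : star (S i) * S i = 1 := by rw [hS.1, if_pos rfl]
  constructor
  · intro I J hIJ
    have h := hX (i :: I) (i :: J) (by simpa using hIJ)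
    rw [cuntzWord_cons, cuntzWord_cons, star_mul] at h
    calc cuntzWord S I * star (cuntzWord S J) * (star (S i) * X * S i)
        = (star (S i) * S i) * cuntzWord S I * star (cuntzWord S J) * (star (S i) * X * S i) := by
          rw [hii, one_mul]
      _ = star (S i) * (S i * cuntzWord S I * (star (cuntzWord S J) * star (S i)) * X) * S i := by
          simp only [mul_assoc]
      _ = star (S i) * X * S i * cuntzWord S I * star (cuntzWord S J) * (star (S i) * S i) := by
          rw [h]; simp only [mul_assoc]
      _ = _ := by rw [hii, mul_one]; simp only [mul_assoc]
  · rw [transferMap_self_apply]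
    have h : ∀ j, S j * (star (S i) * X * S i) * star (S j) = X * (S j * star (S j)) := by
      intro j
      have hj := hX [j] [i] rfl
      simp only [cuntzWord, List.map_cons, List.map_nil, List.prod_cons, List.prod_nil,
        mul_one] at hj
      calc S j * (star (S i) * X * S i) * star (S j)
          = (S j * star (S i) * X) * S i * star (S j) := by simp only [mul_assoc]
        _ = X * S j * (star (S i) * S i) * star (S j) := by rw [hj]; simp only [mul_assoc]
        _ = _ := by rw [hii, mul_one, mul_assoc]
    simp only [h]
    rw [← Finset.mul_sum, hS.2, mul_one]

/-- Moving U past a word in the S_j and past the adjoint of a word produces opposite powers of c,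
which cancel when the lengths agree. -/
theorem mem_uhfCommutant_of_eigen (hS : IsCuntzFamily S) {U : E →L[ℂ] E} {c : ℂ} (hc : c ≠ 0)
    (hU : transferMap S S U = c • U) : U ∈ uhfCommutant S := by
  have h2 : ∀ i, c • (star (S i) * U) = U * star (S i) := by
    intro i
    rw [← mul_smul_comm, ← hU, transferMap_self_apply, Finset.mul_sum, Finset.sum_eq_single i]
    · rw [← mul_assoc, ← mul_assoc, hS.1, if_pos rfl, one_mul]
    · intro j _ hj
      rw [← mul_assoc, ← mul_assoc, hS.1, if_neg hj.symm, zero_mul, zero_mul]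
    · simp
  intro I
  induction I with
  | nil =>
    rintro (_ | ⟨j, J⟩) hIJ
    · simp [cuntzWord]
    · simp at hIJ
  | cons i I ih =>
    rintro (_ | ⟨j, J⟩) hIJ
    · simp at hIJ
    · have hIJ' := ih J (by simpa using hIJ)
      rw [cuntzWord_cons, cuntzWord_cons, star_mul]
      refine smul_right_injective _ hc ?_
      calc c • (S i * cuntzWord S I * (star (cuntzWord S J) * star (S j)) * U)
          = S i * (cuntzWord S I * star (cuntzWord S J)) * (c • (star (S j) * U)) := by
            simp only [mul_assoc, mul_smul_comm]
        _ = S i * (cuntzWord S I * star (cuntzWord S J) * U) * star (S j) := by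
            rw [h2]; simp only [mul_assoc]
        _ = (S i * U) * (cuntzWord S I * star (cuntzWord S J)) * star (S j) := by
            rw [hIJ']; simp only [mul_assoc]
        _ = _ := by
            rw [← hS.smul_mul_eq hU]; simp only [mul_assoc, smul_mul_assoc]

namespace IsCore

/-- Compression to the core is injective on the commutant of `UHF_N`. -/
theorem eq_zero_of_mem_uhfCommutant (hV : IsCore S K V) [FiniteDimensional ℂ K] (i : Fin N)
    {X : E →L[ℂ] E} (hX : X ∈ uhfCommutant S) (h0 : compress K K X = 0) : X = 0 := by
  let φ : uhfCommutant S →ₗ[ℂ] (K →L[ℂ] K) :=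
    { toFun := fun X => compress K K (X : E →L[ℂ] E)
      map_add' := fun X Y => by
        simp [compress, ContinuousLinearMap.add_comp, ContinuousLinearMap.comp_add]
      map_smul' := fun c X => by
        simp [compress, ContinuousLinearMap.smul_comp] }
  have hmap : ∀ A ∈ LinearMap.range φ, (transferMap V V : (K →L[ℂ] K) →ₗ[ℂ] _) A ∈
      LinearMap.range φ := by
    rintro _ ⟨Y, rfl⟩
    exact ⟨⟨_, transferMap_mem_uhfCommutant hV.cuntz Y.2⟩, hV.compress_transferMap hV _⟩
  let τ := (transferMap V V : (K →L[ℂ] K) →ₗ[ℂ] (K →L[ℂ] K)).restrict hmap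
  -- The transfer map is onto the commutant, so τ is onto the finite-dimensional compressed
  -- commutant and therefore injective.
  have hτ : Function.Injective τ := by
    rw [LinearMap.injective_iff_surjective]
    rintro ⟨_, Y, rfl⟩
    obtain ⟨h1, h2⟩ := exists_transferMap_eq hV.cuntz i Y.2
    refine ⟨⟨φ ⟨_, h1⟩, ⟨_, rfl⟩⟩, Subtype.ext ?_⟩
    change transferMap V V (compress K K _) = compress K K _
    rw [← hV.compress_transferMap hV, h2]
  refine hV.eq_zero_of_forall_compress_eq_zero hV fun n => ?_
  -- The n-th preimage is kept in the commutant so that injectivity of τ forces the compression of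
  -- the next preimage to vanish too.
  suffices h : ∃ Y ∈ uhfCommutant S, (transferMap S S ^ n) Y = X ∧ compress K K Y = 0 by
    obtain ⟨Y, -, hY⟩ := h
    exact ⟨Y, hY⟩
  induction n with
  | zero => exact ⟨X, hX, rfl, h0⟩
  | succ n ih =>
    obtain ⟨Y, hY, hYX, hY0⟩ := ih
    obtain ⟨h1, h2⟩ := exists_transferMap_eq hV.cuntz i hY
    refine ⟨_, h1, ?_, ?_⟩
    · rw [pow_succ]
      change (transferMap S S ^ n) (transferMap S S _) = X
      rw [h2, hYX]
    · have h3 : (⟨φ ⟨_, h1⟩, ⟨_, rfl⟩⟩ : LinearMap.range φ) = 0 := by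
        apply hτ
        rw [map_zero]
        refine Subtype.ext ?_
        change transferMap V V (compress K K _) = 0
        rw [← hV.compress_transferMap hV, h2, hY0]
      exact congrArg Subtype.val h3

theorem finiteDimensional_uhfCommutant (hV : IsCore S K V) [FiniteDimensional ℂ K] (i : Fin N) :
    FiniteDimensional ℂ (uhfCommutant S) := by
  let φ : uhfCommutant S →ₗ[ℂ] (K →L[ℂ] K) :=
    { toFun := fun X => compress K K (X : E →L[ℂ] E)
      map_add' := fun X Y => by
        simp [compress, ContinuousLinearMap.add_comp, ContinuousLinearMap.comp_add]
      map_smul' := fun c X => by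
        simp [compress, ContinuousLinearMap.smul_comp] }
  refine FiniteDimensional.of_injective φ ?_
  rw [injective_iff_map_eq_zero]
  exact fun X hX => Subtype.ext (hV.eq_zero_of_mem_uhfCommutant i X.2 hX)

/-- The commutant of `UHF_N` is spanned by the unimodular eigenvectors. -/
theorem mem_of_mem_uhfCommutant (hV : IsCore S K V) [FiniteDimensional ℂ K] (i : Fin N)
    {Q : Submodule ℂ (E →L[ℂ] E)}
    (hQ : ∀ (c : ℂ) (X : E →L[ℂ] E), ‖c‖ = 1 → transferMap S S X = c • X → X ∈ Q)
    {X : E →L[ℂ] E} (hX : X ∈ uhfCommutant S) : X ∈ Q := by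
  have := hV.finiteDimensional_uhfCommutant i
  let f : Module.End ℂ (uhfCommutant S) :=
    (transferMap S S : (E →L[ℂ] E) →ₗ[ℂ] (E →L[ℂ] E)).restrict
      fun Y hY => transferMap_mem_uhfCommutant hV.cuntz hY
  have hf : ∀ Y, ‖f Y‖ ≤ ‖Y‖ := fun Y => norm_transferMap_le hV.cuntz hV.cuntz _
  have hsi : ‖S i‖ ≤ 1 := (S i).opNorm_le_bound zero_le_one fun x => by
    rw [hV.cuntz.norm_apply, one_mul]
  have hle : ∀ c, f.maxGenEigenspace c ≤ Q.comap (uhfCommutant S).subtype := by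
    intro c
    by_cases hev : f.HasEigenvalue c
    · obtain ⟨Y, hY⟩ := hev.exists_hasEigenvector
      have hYc : transferMap S S (Y : E →L[ℂ] E) = c • (Y : E →L[ℂ] E) :=
        congrArg Subtype.val hY.apply_eq_smul
      have hY0 : 0 < ‖(Y : E →L[ℂ] E)‖ := norm_pos_iff.2 fun h => hY.2 (Subtype.ext h)
      have hc1 : ‖c‖ ≤ 1 := by
        have h := norm_transferMap_le hV.cuntz hV.cuntz (Y : E →L[ℂ] E)
        rw [hYc, norm_smul] at h
        nlinarith
      -- The inverse Y ↦ S_i* Y S_i is also contractive, so no eigenvalue lies inside the disc.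
      have hc2 : 1 ≤ ‖c‖ := by
        have hYi : (Y : E →L[ℂ] E) = c • (star (S i) * Y * S i) := by
          rw [mul_assoc, ← mul_smul_comm, hV.cuntz.smul_mul_eq hYc, ← mul_assoc, hV.cuntz.1,
            if_pos rfl, one_mul]
        have hn : ‖star (S i) * (Y : E →L[ℂ] E) * S i‖ ≤ ‖(Y : E →L[ℂ] E)‖ := by
          refine (norm_mul_le _ _).trans ?_
          refine (mul_le_mul (norm_mul_le _ _) hsi (norm_nonneg _) (by positivity)).trans ?_
          rw [norm_star, mul_one]
          exact mul_le_of_le_one_left (norm_nonneg _) hsi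
        have h := congrArg norm hYi
        rw [norm_smul] at h
        have h' : ‖(Y : E →L[ℂ] E)‖ ≤ ‖c‖ * ‖(Y : E →L[ℂ] E)‖ :=
          h.le.trans (mul_le_mul_of_nonneg_left hn (norm_nonneg _))
        nlinarith
      have hc : ‖c‖ = 1 := le_antisymm hc1 hc2
      refine (maxGenEigenspace_le_eigenspace_of_contraction hf hc).trans fun Z hZ => ?_
      exact hQ c Z hc (congrArg Subtype.val (Module.End.mem_eigenspace_iff.1 hZ))
    · have hbot : f.eigenspace c = ⊥ := by
        by_contra h
        exact hev h
      have hinj : LinearMap.ker (f - c • 1) = ⊥ := by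
        rw [← hbot, Module.End.eigenspace_def]
      intro Z hZ
      obtain ⟨n, hn⟩ := (Module.End.mem_maxGenEigenspace f c Z).1 hZ
      have hZ0 : Z = 0 := by
        have hi : Function.Injective ⇑((f - c • 1) ^ n) := by
          rw [Module.End.coe_pow]
          exact (LinearMap.ker_eq_bot.1 hinj).iterate n
        exact hi (by rw [hn, map_zero])
      rw [hZ0]
      exact Submodule.zero_mem _
  have htop : (⊤ : Submodule ℂ (uhfCommutant S)) ≤ Q.comap (uhfCommutant S).subtype := by
    rw [← Module.End.iSup_maxGenEigenspace_eq_top f]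
    exact iSup_le hle
  exact htop (Submodule.mem_top (x := ⟨X, hX⟩))

end IsCore

/-- If `U ^ k = 1`, every vector is a sum of eigenvectors for the `k`-th roots of unity. -/
theorem iSup_eigenspace_eq_top_of_pow_eq_one {M : Type*} [AddCommGroup M] [Module ℂ M]
    {U : Module.End ℂ M} {k : ℕ} (hk : k ≠ 0) (hU : U ^ k = 1) {ζ : ℂ} (hζ : IsPrimitiveRoot ζ k) :
    ⨆ i : Fin k, U.eigenspace (ζ ^ (i : ℕ)) = ⊤ := by
  have hζ0 : ζ ≠ 0 := hζ.ne_zero hk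
  refine eq_top_iff.2 fun x _ => ?_
  -- Discrete Fourier transform of the orbit of x: y i is k times the component of x for the
  -- eigenvalue ζ^i.
  let y : ℕ → M := fun i => ∑ m ∈ Finset.range k, (ζ⁻¹ ^ i) ^ m • (U ^ m) x
  have hy : ∀ i, U (y i) = ζ ^ i • y i := by
    intro i
    have hq : (ζ⁻¹ ^ i) ^ k = 1 := by
      rw [← pow_mul, mul_comm, pow_mul, inv_pow, hζ.pow_eq_one, inv_one, one_pow]
    have h1 : ζ⁻¹ ^ i • U (y i) = y i := by
      have h2 : ∑ m ∈ Finset.range k, (ζ⁻¹ ^ i) ^ (m + 1) • (U ^ (m + 1)) x = y i := by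
        have h3 := Finset.sum_range_succ' (fun m => (ζ⁻¹ ^ i) ^ m • (U ^ m) x) k
        rw [Finset.sum_range_succ, hq, hU, pow_zero, pow_zero] at h3
        exact (add_right_cancel h3).symm
      conv_rhs => rw [← h2]
      change ζ⁻¹ ^ i • U (∑ m ∈ Finset.range k, (ζ⁻¹ ^ i) ^ m • (U ^ m) x) = _
      rw [map_sum, Finset.smul_sum]
      refine Finset.sum_congr rfl fun m _ => ?_
      rw [map_smul, smul_smul, pow_succ' U, Module.End.mul_apply, pow_succ' (ζ⁻¹ ^ i)]
    rw [← h1, smul_smul, map_smul, inv_pow, mul_inv_cancel₀ (pow_ne_zero _ hζ0), one_smul, ← map_smul,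
      ← inv_pow, h1]
  have hsum : ∑ i ∈ Finset.range k, y i = (k : ℂ) • x := by
    rw [Finset.sum_comm]
    rw [Finset.sum_eq_single 0]
    · simp only [pow_zero, one_smul, Module.End.one_apply]
      rw [Finset.sum_const, Finset.card_range, Nat.cast_smul_eq_nsmul]
    · intro m hm hm0
      rw [← Finset.sum_smul]
      have hne : ζ⁻¹ ^ m ≠ 1 := by
        rw [inv_pow, Ne, inv_eq_one]
        exact hζ.pow_ne_one_of_pos_of_lt hm0 (Finset.mem_range.1 hm)
      have hg := geom_sum_mul (ζ⁻¹ ^ m) k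
      have hq : (ζ⁻¹ ^ m) ^ k = 1 := by
        rw [← pow_mul, mul_comm, pow_mul, inv_pow, hζ.pow_eq_one, inv_one, one_pow]
      rw [hq, sub_self] at hg
      have h0 := (mul_eq_zero.1 hg).resolve_right (sub_ne_zero.2 hne)
      have hc : ∑ i ∈ Finset.range k, (ζ⁻¹ ^ i) ^ m = 0 := by
        rw [← h0]
        exact Finset.sum_congr rfl fun i _ => by rw [← pow_mul, ← pow_mul, mul_comm]
      rw [hc, zero_smul]
    · intro h; exact absurd (Finset.mem_range.2 (Nat.pos_of_ne_zero hk)) h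
  have hx : x = (k : ℂ)⁻¹ • ∑ i ∈ Finset.range k, y i := by
    rw [hsum, inv_smul_smul₀ (Nat.cast_ne_zero.2 hk)]
  rw [hx]
  refine Submodule.smul_mem _ _ (Submodule.sum_mem _ fun i hi => ?_)
  exact Submodule.mem_iSup_of_mem (p := fun i : Fin k => U.eigenspace (ζ ^ (i : ℕ)))
    ⟨i, Finset.mem_range.1 hi⟩ (Module.End.mem_eigenspace_iff.2 (hy i))

namespace IsCore

/-- The commutant of UHF_N consists of polynomials in one normalized eigenvector U for a generator
of the group. Such operators are scalar on each eigenspace of U, which yields both irreducibility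
and disjointness. -/
theorem exists_uhf_decomposition (hV : IsCore S K V) [FiniteDimensional ℂ K] [Nontrivial K]
    (hirr : IsIrreducibleRep S) (i₀ : Fin N) :
    ∃ W : Fin (Nat.card (hV.eigenGroup hirr)) → Submodule ℂ E,
      (∀ i, IsIrreducibleOn (uhfAlgebra S) (W i)) ∧
      (∀ i j, i ≠ j → W i ⟂ W j) ∧
      (⨆ i, W i) = ⊤ ∧
      ∀ i j, i ≠ j → AreDisjointOn (uhfAlgebra S) (W i) (W j) := by
  have := hV.finite_eigenGroup hirr
  have := hV.isCyclic_eigenGroup hirr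
  have : Nontrivial E := (Submodule.subtype_injective K).nontrivial
  obtain ⟨g, hg⟩ := IsCyclic.exists_generator (α := hV.eigenGroup hirr)
  set k := Nat.card (hV.eigenGroup hirr) with hk
  have hk0 : k ≠ 0 := Nat.card_pos.ne'
  have hgk : orderOf g = k := orderOf_eq_card_of_forall_mem_zpowers hg
  set ζ : ℂ := ((g : Circle) : ℂ) with hζdef
  have hζ1 : ‖ζ‖ = 1 := Circle.norm_coe _
  have hζ : IsPrimitiveRoot ζ k := by
    have h := IsPrimitiveRoot.orderOf g
    rw [hgk] at h
    exact (h.map_of_injective (f := (hV.eigenGroup hirr).subtype) Subtype.val_injective).map_of_injective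
      (f := Circle.coeHom) Circle.coe_injective
  have hζ0 : ζ ≠ 0 := hζ.ne_zero hk0
  -- normalize the eigenvector so that its `k`-th power is `1`
  obtain ⟨U, hU0, hU, hUk⟩ : ∃ U : E →L[ℂ] E, U ≠ 0 ∧ transferMap S S U = ζ • U ∧ U ^ k = 1 := by
    obtain ⟨U, hU0, hU⟩ := (hV.mem_eigenGroup hirr).1 g.2
    obtain ⟨r, hr0, hr, -⟩ := hV.exists_star_mul_self_eq hirr hζ1 hU0 hU
    have hpow0 : ∀ n, U ^ n ≠ 0 := by
      intro n
      induction n with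
      | zero => rw [pow_zero]; exact one_ne_zero
      | succ n ih =>
        rw [pow_succ']
        exact hV.mul_ne_zero_of_eigen hirr hζ1 hU0 ih hU
    obtain ⟨c, hc⟩ := hV.exists_scalar hirr (X := U ^ k) (by
      rw [hV.cuntz.transferMap_pow hU, hζ.pow_eq_one, one_smul])
    have hc0 : c ≠ 0 := by
      rintro rfl
      exact hpow0 k (by rw [hc, zero_smul])
    obtain ⟨d, hd⟩ := IsAlgClosed.exists_pow_nat_eq c (Nat.pos_of_ne_zero hk0)
    have hd0 : d ≠ 0 := by
      rintro rfl
      exact hc0 (by rw [← hd, zero_pow hk0])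
    refine ⟨d⁻¹ • U, smul_ne_zero (inv_ne_zero hd0) hU0, ?_, ?_⟩
    · rw [map_smul, hU, smul_comm]
    · rw [smul_pow, hc, smul_smul, inv_pow, hd, inv_mul_cancel₀ hc0, one_smul]
  obtain ⟨r, hr0, hr, -⟩ := hV.exists_star_mul_self_eq hirr hζ1 hU0 hU
  let W : Fin k → Submodule ℂ E := fun i =>
    Module.End.eigenspace (U : Module.End ℂ E) (ζ ^ (i : ℕ))
  have hmem : ∀ (c : ℂ) (x : E),
      x ∈ Module.End.eigenspace (U : Module.End ℂ E) c ↔ U x = c • x :=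
    fun c x => Module.End.mem_eigenspace_iff
  have hne : ∀ i j : Fin k, i ≠ j → ζ ^ (i : ℕ) ≠ ζ ^ (j : ℕ) := fun i j hij h =>
    hij (Fin.ext (hζ.pow_inj i.2 j.2 h))
  have hUU : ∀ x y, ⟪U x, U y⟫_ℂ = r * ⟪x, y⟫_ℂ := by
    intro x y
    rw [← star_apply_inner_right]
    have := congrArg (fun A : E →L[ℂ] E => A y) hr
    change star U (U y) = r • y at this
    rw [this, inner_smul_right]
  have htop : ⨆ i, W i = ⊤ := by
    refine iSup_eigenspace_eq_top_of_pow_eq_one hk0 ?_ hζ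
    ext x
    rw [← ContinuousLinearMap.toLinearMap_pow, hUk]
    rfl
  have hUuhf : ∀ A ∈ uhfAlgebra S, A * U = U * A :=
    commute_of_mem_uhfCommutant (mem_uhfCommutant_of_eigen hV.cuntz hζ0 hU)
  have hinv : ∀ i, IsClosedInvariant (uhfAlgebra S) (W i) := fun i =>
    isClosedInvariant_eigenspace U hUuhf _
  -- the eigenspaces are permuted by `S i₀`, hence all nonzero
  have hWne : ∀ i, W i ≠ ⊥ := by
    have hshift : ∀ c, Module.End.eigenspace (U : Module.End ℂ E) c ≠ ⊥ →
        Module.End.eigenspace (U : Module.End ℂ E) (c * ζ⁻¹) ≠ ⊥ := by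
      intro c hc
      obtain ⟨x, hx, hx0⟩ := (Submodule.ne_bot_iff _).1 hc
      refine (Submodule.ne_bot_iff _).2 ⟨S i₀ x, ?_, fun h => hx0 ?_⟩
      · rw [hmem] at hx ⊢
        have h := congrArg (fun A : E →L[ℂ] E => A x) (hV.cuntz.smul_mul_eq hU i₀)
        change ζ • U (S i₀ x) = S i₀ (U x) at h
        rw [hx, map_smul] at h
        rw [mul_comm, mul_smul, ← h, inv_smul_smul₀ hζ0]
      · rw [← norm_eq_zero, ← hV.cuntz.norm_apply i₀, h, norm_zero]
    have hshift' : ∀ c (n : ℕ), Module.End.eigenspace (U : Module.End ℂ E) c ≠ ⊥ →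
        Module.End.eigenspace (U : Module.End ℂ E) (c * ζ⁻¹ ^ n) ≠ ⊥ := by
      intro c n hc
      induction n with
      | zero => simpa using hc
      | succ n ih => rw [pow_succ, ← mul_assoc]; exact hshift _ ih
    obtain ⟨m, hm⟩ : ∃ m, W m ≠ ⊥ := by
      by_contra! h
      have : (⊤ : Submodule ℂ E) = ⊥ := by rw [← htop, iSup_eq_bot]; exact h
      exact bot_ne_top this.symm
    intro i
    -- Each application of S i₀ lowers the exponent by one; m + (k − i) applications lead from m to
    -- i modulo k, avoiding a negative exponent.
    have h := hshift' (ζ ^ (m : ℕ)) (m + (k - i)) hm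
    have he : ζ ^ (m : ℕ) * ζ⁻¹ ^ ((m : ℕ) + (k - i)) = ζ ^ (i : ℕ) := by
      have hki : ζ ^ (k - (i : ℕ)) * ζ ^ (i : ℕ) = 1 := by
        rw [← pow_add, Nat.sub_add_cancel i.2.le, hζ.pow_eq_one]
      rw [pow_add, inv_pow, inv_pow, ← mul_assoc, mul_inv_cancel₀ (pow_ne_zero _ hζ0), one_mul]
      exact (eq_inv_of_mul_eq_one_right hki).symm
    rw [he] at h
    exact h
  -- operators in the commutant are scalar on each eigenspace
  have hscalar : ∀ X ∈ uhfCommutant S, ∀ i, ∃ c : ℂ, ∀ x ∈ W i, X x = c • x := by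
    let Q : Submodule ℂ (E →L[ℂ] E) :=
      { carrier := {X | ∀ i, ∃ c : ℂ, ∀ x ∈ W i, X x = c • x}
        add_mem' := fun {X Y} hX hY i => by
          obtain ⟨c, hc⟩ := hX i
          obtain ⟨d, hd⟩ := hY i
          exact ⟨c + d, fun x hx => by rw [add_apply, hc x hx, hd x hx, add_smul]⟩
        zero_mem' := fun i => ⟨0, fun x _ => by rw [zero_apply, zero_smul]⟩
        smul_mem' := fun a X hX i => by
          obtain ⟨c, hc⟩ := hX i
          exact ⟨a * c, fun x hx => by rw [smul_apply, hc x hx, smul_smul]⟩ }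
    intro X hX
    refine hV.mem_of_mem_uhfCommutant (Q := Q) i₀ (fun c Y hc hY => ?_) hX
    by_cases hY0 : Y = 0
    · rw [hY0]; exact Q.zero_mem
    have hcG : (⟨c, mem_sphere_zero_iff_norm.2 hc⟩ : Circle) ∈ hV.eigenGroup hirr :=
      ⟨Y, hY0, hY⟩
    obtain ⟨m, hm⟩ := (mem_powers_iff_mem_zpowers).2 (hg ⟨_, hcG⟩)
    have hcm : c = ζ ^ m := by
      have h := congrArg (fun z : hV.eigenGroup hirr => ((z : Circle) : ℂ)) hm
      simpa using h.symm
    have hUm : transferMap S S (U ^ m) = c • U ^ m := by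
      rw [hV.cuntz.transferMap_pow hU, hcm]
    have hcc : (starRingEnd ℂ) c * c = 1 := by rw [Complex.conj_mul', hc]; simp
    -- Y and U^m have the same eigenvalue, so Y* U^m is a fixed point and hence scalar; thus Y is a
    -- multiple of U^m.
    obtain ⟨a, ha⟩ := hV.exists_scalar hirr (X := star Y * U ^ m) (by
      rw [hV.cuntz.transferMap_mul (transferMap_star hY) hUm, hcc, one_smul])
    obtain ⟨s, hs0, -, hs⟩ := hV.exists_star_mul_self_eq hirr hc hY0 hY
    have hYU : s • U ^ m = a • Y := by
      have h1 : Y * star Y * U ^ m = Y * (star Y * U ^ m) := mul_assoc _ _ _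
      rwa [ha, hs, smul_mul_assoc, one_mul, mul_smul_comm, mul_one] at h1
    have ha0 : a ≠ 0 := by
      rintro rfl
      rw [zero_smul] at hYU
      have hUm0 := (smul_eq_zero.1 hYU).resolve_left hs0
      have : (U ^ k) ^ m = 0 := by rw [← pow_mul, mul_comm, pow_mul, hUm0, zero_pow hk0]
      rw [hUk, one_pow] at this
      exact one_ne_zero this
    have hYU' : Y = (a⁻¹ * s) • U ^ m := by rw [mul_smul, hYU, inv_smul_smul₀ ha0]
    intro i
    refine ⟨a⁻¹ * s * (ζ ^ (i : ℕ)) ^ m, fun x hx => ?_⟩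
    have hpow : ∀ n : ℕ, (U ^ n) x = (ζ ^ (i : ℕ)) ^ n • x := by
      intro n
      induction n with
      | zero => simp
      | succ n ih =>
        rw [pow_succ']
        change U ((U ^ n) x) = _
        rw [ih, map_smul, (hmem _ _).1 hx, smul_smul, pow_succ]
    rw [hYU', smul_apply, hpow, smul_smul]
  refine ⟨W, fun i => ⟨hWne i, hinv i, fun U₀ hU₀ hle => ?_⟩, fun i j hij => ?_, htop,
    fun i j hij T hT => ?_⟩
  · have := hU₀.hasOrthogonalProjection
    have hP : U₀.starProjection ∈ uhfCommutant S := mem_uhfCommutant_of_commute fun A hA => by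
      ext x
      exact (hU₀.apply_starProjection (star_mem_uhfAlgebra S) hA x).symm
    obtain ⟨c, hc⟩ := hscalar _ hP i
    by_cases h0 : U₀ = ⊥
    · exact Or.inl h0
    · right
      obtain ⟨x, hx, hx0⟩ := (Submodule.ne_bot_iff U₀).1 h0
      have hc1 : c = 1 := by
        have h := hc x (hle hx)
        rw [Submodule.starProjection_eq_self_iff.2 hx] at h
        exact (smul_left_injective ℂ hx0 (by simpa using h)).symm
      refine le_antisymm hle fun y hy => ?_
      rw [← Submodule.starProjection_eq_self_iff, hc y hy, hc1, one_smul]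
  · rw [Submodule.isOrtho_iff_inner_eq]
    intro x hx y hy
    by_cases hx0 : x = 0
    · rw [hx0, inner_zero_left]
    rw [hmem] at hx hy
    have hnorm : ∀ n : ℕ, (starRingEnd ℂ) (ζ ^ n) * ζ ^ n = 1 := by
      intro n; rw [Complex.conj_mul', norm_pow, hζ1]; simp
    have h1 := hUU x x
    rw [hx, inner_smul_left, inner_smul_right, ← mul_assoc, hnorm, one_mul] at h1
    -- Normalizing U^k = 1 does not by itself say that U is unitary; a nonzero eigenvector with
    -- unimodular eigenvalue forces U*U = 1.
    have hr1 : r = 1 := by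
      have hxx : ⟪x, x⟫_ℂ ≠ 0 := inner_self_ne_zero.2 hx0
      exact mul_right_cancel₀ hxx (by rw [← h1, one_mul])
    have h2 := hUU x y
    rw [hx, hy, inner_smul_left, inner_smul_right, hr1, one_mul, ← mul_assoc] at h2
    by_contra hxy
    have h3 : (starRingEnd ℂ) (ζ ^ (i : ℕ)) * ζ ^ (j : ℕ) = 1 :=
      mul_right_cancel₀ hxy (by rw [h2, one_mul])
    have h4 : ζ ^ (i : ℕ) = ζ ^ (j : ℕ) := by
      have h5 : (starRingEnd ℂ) (ζ ^ (i : ℕ)) ≠ 0 := left_ne_zero_of_mul_eq_one h3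
      exact mul_left_cancel₀ h5 ((hnorm i).trans h3.symm)
    exact hne i j hij h4
  · have := (hinv i).hasOrthogonalProjection
    -- Extended by zero, an intertwiner lies in the commutant, so it is scalar on W i; its values
    -- then lie in two different eigenspaces of U.
    let T' : E →L[ℂ] E := (W j).subtypeL ∘L T ∘L (W i).orthogonalProjectionOnto
    have hT' : T' ∈ uhfCommutant S := mem_uhfCommutant_of_commute fun A hA => by
      ext x
      have hAx : ((W i).orthogonalProjectionOnto (A x) : E) =
          A ((W i).orthogonalProjectionOnto x) :=
        (hinv i).apply_starProjection (star_mem_uhfAlgebra S) hA x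
      exact (hT A hA _ _ hAx).symm
    obtain ⟨c, hc⟩ := hscalar _ hT' i
    ext x
    have hTx : (T x : E) = c • (x : E) := by
      rw [← hc x x.2]
      change (T x : E) = (T ((W i).orthogonalProjectionOnto x) : E)
      rw [Submodule.orthogonalProjectionOnto_mem_subspace_eq_self]
    have h1 : U (T x : E) = ζ ^ (j : ℕ) • (T x : E) := (hmem _ _).1 (T x).2
    have h2 : U (T x : E) = ζ ^ (i : ℕ) • (T x : E) := by
      rw [hTx, map_smul, (hmem _ _).1 x.2, smul_comm]
    rw [h2] at h1
    by_contra h0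
    exact hne i j hij (smul_left_injective ℂ h0 h1)

end IsCore

end UHF

/-! ### Characters of the torus and the kernel of z ↦ z^M -/

section TorusCharacters

variable {ν : ℕ}

theorem toCircle_sum {ι : Type*} (s : Finset ι) (f : ι → UnitAddCircle) :
    (AddCircle.toCircle (∑ i ∈ s, f i) : ℂ) = ∏ i ∈ s, (AddCircle.toCircle (f i) : ℂ) := by
  classical
  induction s using Finset.induction_on with
  | empty => simp
  | insert a s ha ih =>
    rw [Finset.sum_insert ha, Finset.prod_insert ha, AddCircle.toCircle_add, Circle.coe_mul, ih]

theorem mFourier_eq_toCircle (n : Fin ν → ℤ) (t : UnitAddTorus (Fin ν)) :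
    UnitAddTorus.mFourier n t = (AddCircle.toCircle (∑ i, n i • t i) : ℂ) := by
  rw [toCircle_sum]
  rfl

theorem mFourier_apply_add (n : Fin ν → ℤ) (s t : UnitAddTorus (Fin ν)) :
    UnitAddTorus.mFourier n (s + t) = UnitAddTorus.mFourier n s * UnitAddTorus.mFourier n t := by
  simp only [mFourier_eq_toCircle, Pi.add_apply, smul_add, Finset.sum_add_distrib,
    AddCircle.toCircle_add, Circle.coe_mul]

theorem mFourier_torusPow (M : Matrix (Fin ν) (Fin ν) ℤ) (m : Fin ν → ℤ)
    (t : UnitAddTorus (Fin ν)) :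
    UnitAddTorus.mFourier m (torusPow M t) = UnitAddTorus.mFourier (M.mulVec m) t := by
  rw [mFourier_eq_toCircle, mFourier_eq_toCircle]
  congr 2
  change ∑ j, m j • ∑ i, M i j • t i = ∑ i, (∑ j, M i j * m j) • t i
  simp only [Finset.smul_sum, Finset.sum_smul]
  rw [Finset.sum_comm]
  refine Finset.sum_congr rfl fun i _ => Finset.sum_congr rfl fun j _ => ?_
  rw [smul_smul, mul_comm]

/-- The characters which are trivial on the kernel of `z ↦ z^M` are the pullbacks. -/
theorem mem_range_mulVec_of_trivial_on_ker {M : Matrix (Fin ν) (Fin ν) ℤ} (hM : M.det ≠ 0)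
    {p : Fin ν → ℤ} (hp : ∀ k ∈ (torusPow M).ker, UnitAddTorus.mFourier p k = 1) :
    p ∈ Set.range M.mulVec := by
  set R : Matrix (Fin ν) (Fin ν) ℝ := (M.map (Int.castRingHom ℝ)).transpose with hR
  have hdet : IsUnit R.det := by
    rw [hR, Matrix.det_transpose, ← RingHom.mapMatrix_apply, ← RingHom.map_det]
    exact isUnit_iff_ne_zero.mpr (by simpa using hM)
  -- Each column of R⁻¹ modulo 1 lies in the kernel; triviality of the character there says that the
  -- corresponding coordinate of M⁻¹p is an integer.
  have hint : ∀ j, ∃ q : ℤ, (q : ℝ) = ∑ i, (p i : ℝ) * R⁻¹ i j := by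
    intro j
    set t : UnitAddTorus (Fin ν) := fun i => ((R⁻¹ i j : ℝ) : UnitAddCircle) with ht
    have hker : t ∈ (torusPow M).ker := by
      rw [AddMonoidHom.mem_ker]
      funext l
      change ∑ i, M i l • ((R⁻¹ i j : ℝ) : UnitAddCircle) = 0
      have h1 : ∑ i, M i l • ((R⁻¹ i j : ℝ) : UnitAddCircle) =
          (((R * R⁻¹) l j : ℝ) : UnitAddCircle) := by
        rw [Matrix.mul_apply]
        simp only [hR, Matrix.transpose_apply, Matrix.map_apply, eq_intCast]
        rw [← QuotientAddGroup.mk'_apply, map_sum]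
        refine Finset.sum_congr rfl fun i _ => ?_
        rw [← zsmul_eq_mul, map_zsmul]
        rfl
      rw [h1, Matrix.mul_nonsing_inv _ hdet, AddCircle.coe_eq_zero_iff]
      rw [Matrix.one_apply]
      by_cases hlj : l = j
      · exact ⟨1, by rw [if_pos hlj, one_smul]⟩
      · exact ⟨0, by rw [if_neg hlj, zero_smul]⟩
    have h2 := hp t hker
    rw [mFourier_eq_toCircle] at h2
    have h3 : ∑ i, p i • t i = 0 := by
      apply AddCircle.injective_toCircle (one_ne_zero (α := ℝ))
      rw [AddCircle.toCircle_zero]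
      exact Circle.coe_injective (h2.trans Circle.coe_one.symm)
    have h4 : ∑ i, p i • t i = ((∑ i, (p i : ℝ) * R⁻¹ i j : ℝ) : UnitAddCircle) := by
      rw [← QuotientAddGroup.mk'_apply, map_sum]
      refine Finset.sum_congr rfl fun i _ => ?_
      rw [← zsmul_eq_mul, map_zsmul]
      rfl
    rw [h4, AddCircle.coe_eq_zero_iff] at h3
    obtain ⟨q, hq⟩ := h3
    exact ⟨q, by rw [← hq]; simp⟩
  choose q hq using hint
  refine ⟨q, ?_⟩
  have h5 : (fun j => (q j : ℝ)) = Matrix.vecMul (fun i => (p i : ℝ)) R⁻¹ := by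
    funext j
    rw [hq j]
    rfl
  have h6 : Matrix.vecMul (fun j => (q j : ℝ)) R = fun i => (p i : ℝ) := by
    rw [h5, Matrix.vecMul_vecMul, Matrix.nonsing_inv_mul _ hdet, Matrix.vecMul_one]
  funext i
  have h7 := congrFun h6 i
  rw [hR, Matrix.vecMul_transpose] at h7
  have h8 : ((M.mulVec q i : ℤ) : ℝ) = (p i : ℝ) := by
    rw [← h7]
    simp [Matrix.mulVec, dotProduct]
  exact_mod_cast h8

theorem mulVec_injective_of_det_ne_zero {M : Matrix (Fin ν) (Fin ν) ℤ} (hM : M.det ≠ 0) :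
    Function.Injective M.mulVec := by
  intro x y h
  have h1 : M.mulVec (x - y) = 0 := by rw [Matrix.mulVec_sub, h, sub_self]
  exact sub_eq_zero.1 (Matrix.eq_zero_of_mulVec_eq_zero hM h1)

/-- Orthogonality of characters: translating by a kernel element where the character is not 1
multiplies the sum by a factor other than 1. -/
theorem sum_ker_mFourier_of_notMem (M : Matrix (Fin ν) (Fin ν) ℤ) (hM : M.det ≠ 0)
    [Fintype (torusPow M).ker] {p : Fin ν → ℤ} (hp : p ∉ Set.range M.mulVec) :
    ∑ k : (torusPow M).ker, UnitAddTorus.mFourier p k.1 = 0 := by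
  obtain ⟨k₀, hk₀, h1⟩ : ∃ k₀ ∈ (torusPow M).ker, UnitAddTorus.mFourier p k₀ ≠ 1 := by
    by_contra! h
    exact hp (mem_range_mulVec_of_trivial_on_ker hM h)
  have h2 : UnitAddTorus.mFourier p k₀ * ∑ k : (torusPow M).ker, UnitAddTorus.mFourier p k.1 =
      ∑ k : (torusPow M).ker, UnitAddTorus.mFourier p k.1 := by
    rw [Finset.mul_sum]
    refine Fintype.sum_equiv (Equiv.addLeft (⟨k₀, hk₀⟩ : (torusPow M).ker)) _ _ fun k => ?_
    rw [← mFourier_apply_add]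
    rfl
  have h3 : (UnitAddTorus.mFourier p k₀ - 1) *
      ∑ k : (torusPow M).ker, UnitAddTorus.mFourier p k.1 = 0 := by
    rw [sub_mul, h2, one_mul, sub_self]
  exact (mul_eq_zero.1 h3).resolve_left (sub_ne_zero.2 h1)

theorem torusPow_add_ker (M : Matrix (Fin ν) (Fin ν) ℤ) (w : UnitAddTorus (Fin ν))
    (k : (torusPow M).ker) : torusPow M (w + k.1) = torusPow M w := by
  rw [map_add, AddMonoidHom.mem_ker.1 k.2, add_zero]

theorem mFourier_mulVec_add_ker (M : Matrix (Fin ν) (Fin ν) ℤ) (m : Fin ν → ℤ)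
    (w : UnitAddTorus (Fin ν)) (k : (torusPow M).ker) :
    UnitAddTorus.mFourier (M.mulVec m) (w + k.1) = UnitAddTorus.mFourier (M.mulVec m) w := by
  rw [← mFourier_torusPow, ← mFourier_torusPow, torusPow_add_ker]

/-- The fibre of `z ↦ z^M` through `w` is a coset of the kernel. -/
def kerEquivFiber (M : Matrix (Fin ν) (Fin ν) ℤ) (w : UnitAddTorus (Fin ν)) :
    (torusPow M).ker ≃ {w' // torusPow M w' = torusPow M w} where
  toFun k := ⟨w + k.1, torusPow_add_ker M w k⟩
  invFun w' := ⟨w'.1 - w, by rw [AddMonoidHom.mem_ker, map_sub, w'.2, sub_self]⟩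
  left_inv k := Subtype.ext (by simp)
  right_inv w' := Subtype.ext (by simp)

theorem card_ker_smul_integral (M : Matrix (Fin ν) (Fin ν) ℤ) [Fintype (torusPow M).ker]
    (f : C(UnitAddTorus (Fin ν), ℂ)) :
    (Fintype.card (torusPow M).ker : ℂ) * ∫ w, f w ∂(torusHaar ν) =
      ∫ w, ∑ k : (torusPow M).ker, f (w + k.1) ∂(torusHaar ν) := by
  rw [integral_finsetSum]
  · simp only [integral_add_right_eq_self (μ := torusHaar ν) (fun w => f w)]
    simp
  · intro k _
    exact Continuous.integrable_of_hasCompactSupport (by fun_prop)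
      (HasCompactSupport.of_compactSpace _)

theorem orthonormal_fourierVec : Orthonormal ℂ (fourierVec (ν := ν)) :=
  UnitAddTorus.orthonormal_mFourier

theorem dense_span_fourierVec : Dense (Submodule.span ℂ (Set.range (fourierVec (ν := ν))) :
    Set (TorusL2 ν)) := by
  rw [dense_iff_closure_eq]
  have h := UnitAddTorus.span_mFourierLp_closure_eq_top (d := Fin ν) (p := 2) (by simp)
  exact congrArg (fun W : Submodule ℂ (TorusL2 ν) => (W : Set (TorusL2 ν))) h

theorem ext_inner_fourierVec {x y : TorusL2 ν}
    (h : ∀ m, ⟪fourierVec m, x⟫_ℂ = ⟪fourierVec m, y⟫_ℂ) : x = y := by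
  refine Dense.eq_of_inner_left (𝕜 := ℂ) dense_span_fourierVec fun v hv => ?_
  induction hv using Submodule.span_induction with
  | mem v hv =>
    obtain ⟨m, rfl⟩ := hv
    rw [← inner_conj_symm, h m, inner_conj_symm]
  | zero => simp
  | add v w _ _ hv hw => rw [inner_add_right, inner_add_right, hv, hw]
  | smul c v _ hv => rw [inner_smul_right, inner_smul_right, hv]

end TorusCharacters

/-! ### The Cuntz relations for polynomial representations -/

namespace PolynomialFilterBank

variable {N ν : ℕ} (F : PolynomialFilterBank N ν)

theorem sum_equiv_fiber {z : UnitAddTorus (Fin ν)} (σ : Fin N ≃ {w // torusPow F.mat w = z})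
    [Fintype (torusPow F.mat).ker] {w : UnitAddTorus (Fin ν)} (hw : torusPow F.mat w = z)
    (f : UnitAddTorus (Fin ν) → ℂ) :
    ∑ k : (torusPow F.mat).ker, f (w + k.1) = ∑ i, f (σ i).1 := by
  subst hw
  exact Fintype.sum_equiv ((kerEquivFiber F.mat w).trans σ.symm) _ _ fun k => by
    rw [Equiv.trans_apply, Equiv.apply_symm_apply]
    rfl

/-- The unitarity hypothesis already enumerates some fibre by N points, and a fibre is a coset of
the kernel. -/
theorem finite_ker : Finite (torusPow F.mat).ker ∧ Nat.card (torusPow F.mat).ker = N := by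
  obtain ⟨z, σ, -⟩ := F.unitary.exists
  have hN : 0 < N := by have := F.two_le; omega
  obtain ⟨w, hw⟩ := σ ⟨0, hN⟩
  subst hw
  let e := (kerEquivFiber F.mat w).trans σ.symm
  exact ⟨Finite.of_equiv _ e.symm, by rw [Nat.card_congr e, Nat.card_fin]⟩

theorem sqrt_inv_mul_self (N : ℕ) : ((√N : ℝ) : ℂ)⁻¹ * ((√N : ℝ) : ℂ)⁻¹ = (N : ℂ)⁻¹ := by
  rw [← mul_inv, ← Complex.ofReal_mul, Real.mul_self_sqrt (Nat.cast_nonneg N)]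
  simp

theorem natCast_ne_zero (F : PolynomialFilterBank N ν) : (N : ℂ) ≠ 0 := by
  have := F.two_le
  exact Nat.cast_ne_zero.2 (by omega)

/-- Unitarity, in terms of sums over the kernel of `z ↦ z^M`. -/
theorem ae_sum_ker [Fintype (torusPow F.mat).ker] : ∀ᵐ w ∂(torusHaar ν),
    (∀ i j, ∑ k : (torusPow F.mat).ker,
      trigPoly (F.coeff i) (w + k.1) * (starRingEnd ℂ) (trigPoly (F.coeff j) (w + k.1)) =
        if i = j then (N : ℂ) else 0) ∧
    ∀ k : (torusPow F.mat).ker, ∑ j,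
      trigPoly (F.coeff j) w * (starRingEnd ℂ) (trigPoly (F.coeff j) (w + k.1)) =
        if k = 0 then (N : ℂ) else 0 := by
  -- The hypothesis concerns almost every base point z; measure preservation transfers it to almost
  -- every w with z = w^M.
  have hq := (measurePreserving_torusPow F.det_ne_zero).quasiMeasurePreserving.ae F.unitary
  filter_upwards [hq] with w hw
  obtain ⟨σ, hσ⟩ := hw
  have hN := F.natCast_ne_zero
  have hs : ∀ a b : ℂ, ((√N : ℝ) : ℂ)⁻¹ * a * (((√N : ℝ) : ℂ)⁻¹ * b) = (N : ℂ)⁻¹ * (a * b) := by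
    intro a b
    rw [mul_mul_mul_comm, sqrt_inv_mul_self]
  have hconj : (starRingEnd ℂ) ((√N : ℝ) : ℂ)⁻¹ = ((√N : ℝ) : ℂ)⁻¹ := by
    rw [map_inv₀, Complex.conj_ofReal]
  constructor
  · intro i j
    have h := congrFun (congrFun (Matrix.mem_unitaryGroup_iff.1 hσ) i) j
    rw [Matrix.mul_apply] at h
    simp only [Matrix.star_apply, Matrix.of_apply, RCLike.star_def, map_mul, hconj, hs,
      Matrix.one_apply] at h
    rw [← Finset.mul_sum, inv_mul_eq_iff_eq_mul₀ hN] at h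
    rw [F.sum_equiv_fiber σ rfl
      (fun v => trigPoly (F.coeff i) v * (starRingEnd ℂ) (trigPoly (F.coeff j) v)), h]
    split_ifs <;> simp
  · intro k
    set a := σ.symm (kerEquivFiber F.mat w 0) with ha
    set b := σ.symm (kerEquivFiber F.mat w k) with hb
    have ha' : (σ a).1 = w := by
      rw [ha, Equiv.apply_symm_apply]
      exact add_zero w
    have hb' : (σ b).1 = w + k.1 := by
      rw [hb, Equiv.apply_symm_apply]
      rfl
    have hab : b = a ↔ k = 0 := by
      rw [ha, hb, EmbeddingLike.apply_eq_iff_eq, EmbeddingLike.apply_eq_iff_eq]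
    have h := congrFun (congrFun (Matrix.mem_unitaryGroup_iff'.1 hσ) b) a
    rw [Matrix.mul_apply] at h
    simp only [Matrix.star_apply, Matrix.of_apply, RCLike.star_def, map_mul, hconj, hs,
      Matrix.one_apply, ha', hb'] at h
    rw [← Finset.mul_sum, inv_mul_eq_iff_eq_mul₀ hN] at h
    simp only [hab] at h
    simp only [mul_comm (trigPoly _ w)]
    rw [h]
    split_ifs <;> simp

theorem rep_fourierVec (j : Fin N) (m : Fin ν → ℤ) :
    F.rep j (fourierVec m) = ContinuousMap.toLp 2 (torusHaar ν) ℂ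
      (trigPoly (F.coeff j) * UnitAddTorus.mFourier (F.mat.mulVec m)) := by
  refine Lp.ext ?_
  have h1 := F.rep_apply_ae j (fourierVec m)
  have h2 := (measurePreserving_torusPow F.det_ne_zero).quasiMeasurePreserving.ae
    (ContinuousMap.coeFn_toLp (p := 2) (𝕜 := ℂ) (torusHaar ν) (UnitAddTorus.mFourier m))
  have h3 := ContinuousMap.coeFn_toLp (p := 2) (𝕜 := ℂ) (torusHaar ν)
    (trigPoly (F.coeff j) * UnitAddTorus.mFourier (F.mat.mulVec m))
  filter_upwards [h1, h2, h3] with w h1 h2 h3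
  rw [h1, h3, ContinuousMap.mul_apply, ← mFourier_torusPow]
  exact congrArg _ h2

theorem rep_fourierVec_eq_sum (j : Fin N) (m : Fin ν → ℤ) :
    F.rep j (fourierVec m) =
      (F.coeff j).sum fun l c => c • fourierVec (l + F.mat.mulVec m) := by
  rw [rep_fourierVec, trigPoly, Finsupp.sum, Finsupp.sum, Finset.sum_mul, map_sum]
  refine Finset.sum_congr rfl fun l _ => ?_
  rw [smul_mul_assoc, map_smul]
  congr 2
  ext w
  exact UnitAddTorus.mFourier_add.symm

theorem inner_fourierVec_rep (j : Fin N) (n m : Fin ν → ℤ) :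
    ⟪fourierVec n, F.rep j (fourierVec m)⟫_ℂ = F.coeff j (n - F.mat.mulVec m) := by
  classical
  rw [rep_fourierVec_eq_sum, Finsupp.sum, inner_sum]
  simp only [inner_smul_right, orthonormal_iff_ite.1 orthonormal_fourierVec]
  simp only [mul_ite, mul_one, mul_zero, ← sub_eq_iff_eq_add]
  rw [Finset.sum_ite_eq]
  split_ifs with h
  · rfl
  · exact (Finsupp.notMem_support_iff.1 h).symm

theorem inner_fourierVec_star_rep (j : Fin N) (n m : Fin ν → ℤ) :
    ⟪fourierVec m, star (F.rep j) (fourierVec n)⟫_ℂ =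
      (starRingEnd ℂ) (F.coeff j (n - F.mat.mulVec m)) := by
  rw [star_apply_inner_right, ← inner_conj_symm, inner_fourierVec_rep]

/-- Averaging the inner product integral over the kernel reduces it to row orthogonality; z ↦ z^M
then preserves the remaining integral of characters. -/
theorem star_rep_mul_rep (i j : Fin N) :
    star (F.rep i) * F.rep j = if i = j then 1 else 0 := by
  obtain ⟨hfin, hcard⟩ := F.finite_ker
  have := Fintype.ofFinite (torusPow F.mat).ker
  refine ContinuousLinearMap.ext_on dense_span_fourierVec ?_
  rintro _ ⟨n, rfl⟩
  refine ext_inner_fourierVec fun m => ?_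
  change ⟪fourierVec m, star (F.rep i) (F.rep j (fourierVec n))⟫_ℂ = _
  rw [star_apply_inner_right, rep_fourierVec, rep_fourierVec, ContinuousMap.inner_toLp]
  have h1 := card_ker_smul_integral F.mat
    ((trigPoly (F.coeff j) * UnitAddTorus.mFourier (F.mat.mulVec n)) *
      star (trigPoly (F.coeff i) * UnitAddTorus.mFourier (F.mat.mulVec m)))
  rw [← Nat.card_eq_fintype_card, hcard] at h1
  have h2 : ∫ w, ∑ k : (torusPow F.mat).ker,
      ((trigPoly (F.coeff j) * UnitAddTorus.mFourier (F.mat.mulVec n)) *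
        star (trigPoly (F.coeff i) * UnitAddTorus.mFourier (F.mat.mulVec m))) (w + k.1)
        ∂(torusHaar ν) =
      ∫ w, (if j = i then (N : ℂ) else 0) * (UnitAddTorus.mFourier n (torusPow F.mat w) *
        (starRingEnd ℂ) (UnitAddTorus.mFourier m (torusPow F.mat w))) ∂(torusHaar ν) := by
    refine integral_congr_ae ?_
    filter_upwards [F.ae_sum_ker] with w hw
    rw [← hw.1 j i, Finset.sum_mul]
    refine Finset.sum_congr rfl fun k _ => ?_
    simp only [ContinuousMap.mul_apply, ContinuousMap.star_apply, RCLike.star_def, map_mul,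
      mFourier_mulVec_add_ker, mFourier_torusPow]
    ring
  have h3 : ∫ w, (UnitAddTorus.mFourier n (torusPow F.mat w) *
      (starRingEnd ℂ) (UnitAddTorus.mFourier m (torusPow F.mat w))) ∂(torusHaar ν) =
      ⟪fourierVec m, fourierVec n⟫_ℂ := by
    rw [fourierVec, fourierVec, ContinuousMap.inner_toLp]
    have hmp := measurePreserving_torusPow F.det_ne_zero
    have h := integral_map (μ := torusHaar ν) hmp.measurable.aemeasurable
      (f := fun z => UnitAddTorus.mFourier n z * (starRingEnd ℂ) (UnitAddTorus.mFourier m z))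
      (Continuous.aestronglyMeasurable (by fun_prop))
    rw [hmp.map_eq] at h
    exact h.symm
  rw [h2, integral_const_mul, h3] at h1
  refine mul_left_cancel₀ F.natCast_ne_zero (h1.trans ?_)
  by_cases hij : i = j
  · rw [if_pos hij, if_pos hij.symm]
    rfl
  · rw [if_neg hij, if_neg (Ne.symm hij), zero_mul, zero_apply, inner_zero_right, mul_zero]

open Classical in
/-- The exponents in the support of `m_j` that contribute to `S_j* eₙ`. -/
def contributing (j : Fin N) (n : Fin ν → ℤ) : Finset (Fin ν → ℤ) :=
  (F.coeff j).support.filter fun l => n - l ∈ Set.range F.mat.mulVec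

theorem exists_mulVec_eq {j : Fin N} {n l : Fin ν → ℤ} (hl : l ∈ F.contributing j n) :
    ∃ m, F.mat.mulVec m = n - l := by
  classical
  exact (Finset.mem_filter.1 hl).2

theorem star_rep_fourierVec (j : Fin N) (n : Fin ν → ℤ) :
    star (F.rep j) (fourierVec n) = ∑ l ∈ (F.contributing j n).attach,
      (starRingEnd ℂ) (F.coeff j l) • fourierVec (F.exists_mulVec_eq l.2).choose := by
  classical
  refine ext_inner_fourierVec fun m => ?_
  rw [inner_fourierVec_star_rep, inner_sum]
  simp only [inner_smul_right, orthonormal_iff_ite.1 orthonormal_fourierVec]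
  have hiff : ∀ l : {l // l ∈ F.contributing j n},
      m = (F.exists_mulVec_eq l.2).choose ↔ n - F.mat.mulVec m = l := by
    intro l
    have hs := (F.exists_mulVec_eq l.2).choose_spec
    constructor
    · intro h
      rw [h, hs]
      abel
    · intro h
      refine mulVec_injective_of_det_ne_zero F.det_ne_zero ?_
      rw [hs, ← h]
      abel
  simp only [hiff]
  rw [Finset.sum_attach (F.contributing j n) (fun l => (starRingEnd ℂ) (F.coeff j l) *
    if n - F.mat.mulVec m = l then 1 else 0)]
  simp only [mul_ite, mul_one, mul_zero]
  rw [Finset.sum_ite_eq]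
  split_ifs with h
  · rfl
  · have h0 : n - F.mat.mulVec m ∉ (F.coeff j).support := fun h' =>
      h (Finset.mem_filter.2 ⟨h', m, by abel⟩)
    rw [Finsupp.notMem_support_iff.1 h0, map_zero]

/-- Summing over the kernel annihilates the exponents outside the range of M. Thus S_j S_j* e_n is
m_j times a fibre average, and `sum_rep_star_rep_fourierVec` follows from column orthogonality. -/
theorem sum_contributing [Fintype (torusPow F.mat).ker] (hcard : Nat.card (torusPow F.mat).ker = N)
    (j : Fin N) (n : Fin ν → ℤ) (w : UnitAddTorus (Fin ν)) :
    N * ∑ l ∈ F.contributing j n,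
      (starRingEnd ℂ) (F.coeff j l) * UnitAddTorus.mFourier (n - l) w =
    ∑ k : (torusPow F.mat).ker, (starRingEnd ℂ) (trigPoly (F.coeff j) (w + k.1)) *
      UnitAddTorus.mFourier n (w + k.1) := by
  classical
  have h1 : ∀ v, (starRingEnd ℂ) (trigPoly (F.coeff j) v) * UnitAddTorus.mFourier n v =
      ∑ l ∈ (F.coeff j).support,
        (starRingEnd ℂ) (F.coeff j l) * UnitAddTorus.mFourier (n - l) v := by
    intro v
    rw [trigPoly, Finsupp.sum, ContinuousMap.coe_sum, Finset.sum_apply, map_sum, Finset.sum_mul]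
    refine Finset.sum_congr rfl fun l _ => ?_
    rw [sub_eq_neg_add, UnitAddTorus.mFourier_add, UnitAddTorus.mFourier_neg]
    simp [mul_assoc]
  simp only [h1]
  rw [Finset.sum_comm, contributing, Finset.sum_filter, Finset.mul_sum]
  refine Finset.sum_congr rfl fun l _ => ?_
  rw [← Finset.mul_sum]
  split_ifs with h
  · obtain ⟨m, hm⟩ := h
    rw [← hm]
    simp only [mFourier_mulVec_add_ker]
    rw [Finset.sum_const, Finset.card_univ, ← Nat.card_eq_fintype_card, hcard, nsmul_eq_mul]
    ring
  · simp only [mFourier_apply_add]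
    rw [← Finset.mul_sum, sum_ker_mFourier_of_notMem F.mat F.det_ne_zero h, mul_zero, mul_zero,
      mul_zero]

theorem sum_rep_star_rep_fourierVec (n : Fin ν → ℤ) :
    ∑ j, F.rep j (star (F.rep j) (fourierVec n)) = fourierVec n := by
  obtain ⟨hfin, hcard⟩ := F.finite_ker
  have := Fintype.ofFinite (torusPow F.mat).ker
  have h1 : ∀ j, F.rep j (star (F.rep j) (fourierVec n)) =
      ContinuousMap.toLp 2 (torusHaar ν) ℂ (trigPoly (F.coeff j) *
        ∑ l ∈ F.contributing j n,
          (starRingEnd ℂ) (F.coeff j l) • UnitAddTorus.mFourier (n - l)) := by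
    intro j
    rw [star_rep_fourierVec, map_sum, ← Finset.sum_attach (F.contributing j n), Finset.mul_sum,
      map_sum]
    refine Finset.sum_congr rfl fun l _ => ?_
    rw [map_smul, rep_fourierVec, (F.exists_mulVec_eq l.2).choose_spec, mul_smul_comm, map_smul]
  simp only [h1]
  rw [← map_sum, fourierVec]
  refine Lp.ext ?_
  have h2 := ContinuousMap.coeFn_toLp (p := 2) (𝕜 := ℂ) (torusHaar ν)
    (∑ j, trigPoly (F.coeff j) * ∑ l ∈ F.contributing j n,
      (starRingEnd ℂ) (F.coeff j l) • UnitAddTorus.mFourier (n - l))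
  have h3 := ContinuousMap.coeFn_toLp (p := 2) (𝕜 := ℂ) (torusHaar ν) (UnitAddTorus.mFourier n)
  filter_upwards [h2, h3, F.ae_sum_ker] with w h2 h3 hw
  rw [h2, h3]
  refine mul_left_cancel₀ F.natCast_ne_zero ?_
  have h4 : (N : ℂ) * (∑ j, trigPoly (F.coeff j) * ∑ l ∈ F.contributing j n,
      (starRingEnd ℂ) (F.coeff j l) • UnitAddTorus.mFourier (n - l)) w =
      ∑ j, trigPoly (F.coeff j) w * ((N : ℂ) * ∑ l ∈ F.contributing j n,
        (starRingEnd ℂ) (F.coeff j l) * UnitAddTorus.mFourier (n - l) w) := by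
    rw [ContinuousMap.coe_sum, Finset.sum_apply, Finset.mul_sum]
    refine Finset.sum_congr rfl fun j _ => ?_
    rw [ContinuousMap.mul_apply, ContinuousMap.coe_sum, Finset.sum_apply, mul_left_comm]
    rfl
  rw [h4]
  simp only [F.sum_contributing hcard, Finset.mul_sum, ← mul_assoc]
  rw [Finset.sum_comm]
  simp only [← Finset.sum_mul, hw.2]
  rw [Finset.sum_eq_single 0]
  · simp
  · intro k _ hk; simp [hk]
  · simp

theorem isCuntzFamily : IsCuntzFamily F.rep := by
  refine ⟨F.star_rep_mul_rep, ContinuousLinearMap.ext_on dense_span_fourierVec ?_⟩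
  rintro _ ⟨n, rfl⟩
  rw [sum_apply]
  exact F.sum_rep_star_rep_fourierVec n

end PolynomialFilterBank

/-! ### Adapted norms and expansive matrices -/

section AdaptedNorm

/-- An operator with spectral radius less than `1` contracts a norm dominating the given one. -/
theorem exists_adapted_norm {X : Type*} [NormedAddCommGroup X] [NormedSpace ℂ X] [CompleteSpace X]
    [Nontrivial X] (T : X →L[ℂ] X) (hT : ∀ z ∈ spectrum ℂ T, ‖z‖ < 1) :
    ∃ (θ : ℝ) (g : X → ℝ), 0 < θ ∧ θ < 1 ∧ (∀ x y, g (x - y) ≤ g x + g y) ∧ (∀ x, ‖x‖ ≤ g x) ∧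
      ∀ x, g (T x) ≤ θ * g x := by
  have hr : spectralRadius ℂ T < 1 := by
    refine spectrum.spectralRadius_lt_of_forall_lt T (r := 1) fun z hz => ?_
    exact hT z hz
  obtain ⟨p, hp1, hp2⟩ : ∃ p : ℕ, p ≠ 0 ∧ ‖T ^ p‖ < 1 := by
    have h := (spectrum.pow_nnnorm_pow_one_div_tendsto_nhds_spectralRadius T).eventually
      (gt_mem_nhds hr)
    obtain ⟨p, hp, hp0⟩ := (h.and (Filter.eventually_ne_atTop 0)).exists
    refine ⟨p, hp0, ?_⟩
    by_contra hge
    rw [not_lt] at hge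
    have h1 : (1 : ENNReal) ≤ (‖T ^ p‖₊ : ENNReal) := ENNReal.one_le_coe_iff.2 hge
    have h2 := ENNReal.one_le_rpow (z := 1 / (p : ℝ)) h1 (by positivity)
    exact absurd hp (not_lt.2 h2)
  -- The 1/2 keeps θ positive even when T^p = 0.
  set q : ℝ := max ‖T ^ p‖ (1 / 2) with hq
  have hq0 : 0 < q := lt_of_lt_of_le (by norm_num) (le_max_right _ _)
  have hq1 : q < 1 := max_lt hp2 (by norm_num)
  set θ : ℝ := q ^ ((p : ℝ)⁻¹) with hθ
  have hθ0 : 0 < θ := Real.rpow_pos_of_pos hq0 _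
  have hθ1 : θ < 1 := Real.rpow_lt_one hq0.le hq1 (by positivity)
  have hθp : θ ^ p = q := Real.rpow_inv_natCast_pow hq0.le hp1
  have hTx : ∀ x, θ⁻¹ ^ p * ‖(T ^ p) x‖ ≤ ‖x‖ := by
    intro x
    rw [inv_pow, hθp, inv_mul_le_iff₀ hq0]
    exact ((T ^ p).le_opNorm x).trans
      (mul_le_mul_of_nonneg_right (le_max_left _ _) (norm_nonneg _))
  -- Applying T shifts the weighted orbit sum; the new last term is at most the lost first term
  -- because θ^p ≥ ‖T^p‖.
  refine ⟨θ, fun x => ∑ k ∈ Finset.range p, θ⁻¹ ^ k * ‖(T ^ k) x‖, hθ0, hθ1, ?_, ?_, ?_⟩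
  · intro x y
    rw [← Finset.sum_add_distrib]
    refine Finset.sum_le_sum fun k _ => ?_
    rw [← mul_add, map_sub]
    exact mul_le_mul_of_nonneg_left (norm_sub_le _ _) (by positivity)
  · intro x
    have h := Finset.single_le_sum (f := fun k => θ⁻¹ ^ k * ‖(T ^ k) x‖)
      (fun k _ => by positivity) (Finset.mem_range.2 (Nat.pos_of_ne_zero hp1))
    simpa using h
  · intro x
    have h1 := Finset.sum_range_succ' (fun k => θ⁻¹ ^ k * ‖(T ^ k) x‖) p
    rw [Finset.sum_range_succ] at h1
    have h2 : ∑ k ∈ Finset.range p, θ⁻¹ ^ k * ‖(T ^ k) (T x)‖ =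
        θ * ∑ k ∈ Finset.range p, θ⁻¹ ^ (k + 1) * ‖(T ^ (k + 1)) x‖ := by
      rw [Finset.mul_sum]
      refine Finset.sum_congr rfl fun k _ => ?_
      rw [pow_succ T, pow_succ θ⁻¹]
      change _ = θ * (θ⁻¹ ^ k * θ⁻¹ * ‖(T ^ k) (T x)‖)
      field_simp
    dsimp only
    rw [h2]
    refine mul_le_mul_of_nonneg_left ?_ hθ0.le
    have h3 := hTx x
    simp only [pow_zero, one_mul] at h1
    have h4 : ‖(1 : X →L[ℂ] X) x‖ = ‖x‖ := rfl
    linarith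

end AdaptedNorm

/-! ### Existence of finite absorbing coinvariant sets -/

namespace PolynomialFilterBank

variable {N ν : ℕ} (F : PolynomialFilterBank N ν)

theorem nonempty_index (F : PolynomialFilterBank N ν) : Nonempty (Fin ν) := by
  by_contra h
  rw [not_nonempty_iff] at h
  have h1 := F.natAbs_det
  have h2 := F.two_le
  rw [Matrix.det_isEmpty] at h1
  simp at h1
  omega

/-- For an expansive matrix there is a weight on `ℤ^ν`, with finite sublevel sets, contracted by
the inverse matrix. -/
theorem exists_weight (hF : F.IsExpansive) :
    ∃ (θ : ℝ) (g : (Fin ν → ℤ) → ℝ), 0 < θ ∧ θ < 1 ∧ (∀ n, 0 ≤ g n) ∧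
      (∀ r, {n | g n ≤ r}.Finite) ∧
      ∀ m n l, F.mat.mulVec m = n - l → g m ≤ θ * (g n + g l) := by
  have := F.nonempty_index
  set A : Matrix (Fin ν) (Fin ν) ℂ := F.mat.map (Int.castRingHom ℂ) with hA
  have hdet : IsUnit A.det := by
    rw [hA, ← RingHom.mapMatrix_apply, ← RingHom.map_det]
    exact isUnit_iff_ne_zero.mpr (by simpa using F.det_ne_zero)
  let T : (Fin ν → ℂ) →L[ℂ] (Fin ν → ℂ) := LinearMap.toContinuousLinearMap (Matrix.toLin' A⁻¹)
  have hTapp : ∀ x, T x = A⁻¹.mulVec x := fun x => rfl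
  obtain ⟨θ, g, hθ0, hθ1, hsub, hnorm, hT⟩ := exists_adapted_norm T (by
    intro z hz
    obtain ⟨x, hx0, hx⟩ := (mem_spectrum_iff_exists_eigenvector T z).1 hz
    have h1 : x = z • A.mulVec x := by
      have h := congrArg A.mulVec hx
      rwa [hTapp, Matrix.mulVec_mulVec, Matrix.mul_nonsing_inv _ hdet, Matrix.one_mulVec,
        Matrix.mulVec_smul] at h
    have hz0 : z ≠ 0 := by
      rintro rfl
      exact hx0 (by rw [h1, zero_smul])
    have h2 : A.mulVec x = z⁻¹ • x := by
      conv_rhs => rw [h1]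
      rw [inv_smul_smul₀ hz0]
    have h3 : z⁻¹ ∈ spectrum ℂ A := by
      rw [← Matrix.spectrum_toLin', ← Module.End.hasEigenvalue_iff_mem_spectrum]
      exact Module.End.hasEigenvalue_of_hasEigenvector
        (x := x) ⟨Module.End.mem_eigenspace_iff.2 h2, hx0⟩
    have h4 := hF _ h3
    rw [norm_inv] at h4
    exact (one_lt_inv₀ (norm_pos_iff.2 hz0)).1 h4)
  refine ⟨θ, fun n => g fun i => (n i : ℂ), hθ0, hθ1, fun n => (norm_nonneg _).trans (hnorm _),
    fun r => ?_, fun m n l h => ?_⟩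
  · refine (Set.finite_Icc (fun _ : Fin ν => -⌈r⌉) fun _ => ⌈r⌉).subset fun n hn => ?_
    have hi : ∀ i, |(n i : ℝ)| ≤ r := by
      intro i
      have h1 := (norm_le_pi_norm (fun i => (n i : ℂ)) i).trans ((hnorm _).trans hn)
      rwa [Complex.norm_intCast] at h1
    have hi' : ∀ i, |n i| ≤ ⌈r⌉ := by
      intro i
      have h2 : ((|n i| : ℤ) : ℝ) ≤ (⌈r⌉ : ℝ) := by
        rw [Int.cast_abs]
        exact (hi i).trans (Int.le_ceil r)
      exact_mod_cast h2
    exact ⟨fun i => (abs_le.1 (hi' i)).1, fun i => (abs_le.1 (hi' i)).2⟩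
  · have h1 : A.mulVec (fun i => (m i : ℂ)) = (fun i => (n i : ℂ)) - fun i => (l i : ℂ) := by
      funext i
      have h2 := congrArg (fun a : ℤ => (a : ℂ)) (congrFun h i)
      simp only [Matrix.mulVec, dotProduct, Pi.sub_apply, Int.cast_sub, Int.cast_sum,
        Int.cast_mul] at h2
      exact h2
    have h3 : (fun i => (m i : ℂ)) = T ((fun i => (n i : ℂ)) - fun i => (l i : ℂ)) := by
      rw [hTapp, ← h1, Matrix.mulVec_mulVec, Matrix.nonsing_inv_mul _ hdet, Matrix.one_mulVec]
    dsimp only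
    rw [h3]
    exact (hT _).trans (mul_le_mul_of_nonneg_left (hsub _ _) hθ0.le)

theorem exists_absorbing_coinvariant (hF : F.IsExpansive) :
    ∃ H, F.IsAbsorbing H ∧ F.IsCoinvariant H := by
  obtain ⟨θ, g, hθ0, hθ1, hg0, hfin, hg⟩ := F.exists_weight hF
  obtain ⟨Λ, hΛ0, hΛ⟩ : ∃ Λ : ℝ, 0 ≤ Λ ∧ ∀ j, ∀ l ∈ (F.coeff j).support, g l ≤ Λ := by
    refine ⟨∑ j, ∑ l ∈ (F.coeff j).support, g l,
      Finset.sum_nonneg fun j _ => Finset.sum_nonneg fun l _ => hg0 l, fun j l hl => ?_⟩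
    refine (Finset.single_le_sum (f := g) (fun l _ => hg0 l) hl).trans ?_
    exact Finset.single_le_sum (f := fun j => ∑ l ∈ (F.coeff j).support, g l)
      (fun j _ => Finset.sum_nonneg fun l _ => hg0 l) (Finset.mem_univ j)
  set R : ℝ := θ * Λ / (1 - θ) with hR
  -- R is the fixed point of t ↦ θ(t + Λ), so the excess of the weight over R shrinks by θ under
  -- every S_j*. The set H is the sublevel set at R + 1, leaving room for the excess to fall to at
  -- most 1 in finitely many steps.
  have h1θ : 0 < 1 - θ := by linarith
  have hRθ : θ * (R + Λ) = R := by
    rw [hR]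
    field_simp
    ring
  let B : ℝ → Submodule ℂ (TorusL2 ν) := fun t => Submodule.span ℂ (fourierVec '' {n | g n ≤ R + t})
  have hBmono : Monotone B := fun s t hst =>
    Submodule.span_mono (Set.image_mono fun n (hn : g n ≤ R + s) =>
      (hn.trans (by linarith) : g n ≤ R + t))
  have hstep : ∀ t j, ∀ x ∈ B t, star (F.rep j) x ∈ B (θ * t) := by
    intro t j x hx
    induction hx using Submodule.span_induction with
    | mem x hx =>
      obtain ⟨n, hn, rfl⟩ := hx
      rw [star_rep_fourierVec]
      refine Submodule.sum_mem _ fun l _ => Submodule.smul_mem _ _ (Submodule.subset_span ?_)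
      refine ⟨_, ?_, rfl⟩
      have h1 := hg _ n l (F.exists_mulVec_eq l.2).choose_spec
      have h2 : g l ≤ Λ := by
        classical
        exact hΛ j l (Finset.mem_filter.1 l.2).1
      have h3 : g n ≤ R + t := hn
      refine h1.trans ?_
      calc θ * (g n + g l) ≤ θ * (R + t + Λ) :=
            mul_le_mul_of_nonneg_left (add_le_add h3 h2) hθ0.le
        _ = θ * (R + Λ) + θ * t := by ring
        _ = R + θ * t := by rw [hRθ]
    | zero => rw [map_zero]; exact Submodule.zero_mem _
    | add x y _ _ hx hy => rw [map_add]; exact Submodule.add_mem _ hx hy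
    | smul c x _ hx => rw [map_smul]; exact Submodule.smul_mem _ _ hx
  have hword : ∀ (I : List (Fin N)) t, ∀ x ∈ B t,
      star (cuntzWord F.rep I) x ∈ B (θ ^ I.length * t) := by
    intro I
    induction I with
    | nil =>
      intro t x hx
      simpa [cuntzWord] using hx
    | cons i I ih =>
      intro t x hx
      rw [cuntzWord_cons, star_mul, List.length_cons, pow_succ, mul_assoc]
      exact ih _ _ (hstep t i x hx)
  have hH : fourierSpan (hfin (R + 1)).toFinset = B 1 := by
    rw [fourierSpan, Set.Finite.coe_toFinset]
  refine ⟨(hfin (R + 1)).toFinset, fun n => ?_, fun j x hx => ?_⟩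
  · rw [hH]
    set t := max (g n - R) 1 with ht
    have ht0 : 0 < t := lt_of_lt_of_le one_pos (le_max_right _ _)
    obtain ⟨L, hL⟩ := exists_pow_lt_of_lt_one (inv_pos.2 ht0) hθ1
    refine ⟨L, fun I hI => ?_⟩
    have hn : fourierVec n ∈ B t := by
      refine Submodule.subset_span ⟨n, ?_, rfl⟩
      have := le_max_left (g n - R) 1
      change g n ≤ R + t
      linarith
    refine hBmono ?_ (hword I t _ hn)
    have h1 : θ ^ I.length ≤ t⁻¹ := (pow_le_pow_of_le_one hθ0.le hθ1.le hI).trans hL.le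
    calc θ ^ I.length * t ≤ t⁻¹ * t := mul_le_mul_of_nonneg_right h1 ht0.le
      _ = 1 := inv_mul_cancel₀ ht0.ne'
  · rw [hH] at hx ⊢
    exact hBmono (by linarith) (hstep 1 j x hx)

end PolynomialFilterBank

/-! ### Absorbing sets as cores, and cyclicity -/

section AbsorbingSets

theorem mem_absorbed_of_forall_word {N : ℕ} {E : Type*} [NormedAddCommGroup E]
    [InnerProductSpace ℂ E] [CompleteSpace E] {S : Fin N → E →L[ℂ] E} {K : Submodule ℂ E} (n : ℕ) :
    ∀ x, (∀ I : List (Fin N), I.length = n → star (cuntzWord S I) x ∈ K) → x ∈ absorbed S K n := by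
  induction n with
  | zero =>
    intro x hx
    have h := hx [] rfl
    rw [cuntzWord, List.map_nil, List.prod_nil, star_one] at h
    exact h
  | succ n ih =>
    intro x hx
    refine mem_absorbed_succ.2 fun j => ih _ fun I hI => ?_
    have h := hx (j :: I) (by simp [hI])
    rwa [cuntzWord_cons, star_mul] at h

/-- An absorbed vector is rebuilt from K by x = ∑ S_j S_j* x, used once per level; this is why
condition (a) alone gives cyclicity. -/
theorem absorbed_le_of_invariant {N : ℕ} {E : Type*} [NormedAddCommGroup E]
    [InnerProductSpace ℂ E] [CompleteSpace E] {S : Fin N → E →L[ℂ] E} (hS : IsCuntzFamily S)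
    {K Z : Submodule ℂ E} (hK : K ≤ Z) (hZ : ∀ j, ∀ x ∈ Z, S j x ∈ Z) (n : ℕ) :
    absorbed S K n ≤ Z := by
  induction n with
  | zero => exact hK
  | succ n ih =>
    intro x hx
    rw [← hS.sum_apply_star_apply x]
    exact Submodule.sum_mem _ fun j _ => hZ j _ (ih (mem_absorbed_succ.1 hx j))

namespace PolynomialFilterBank

variable {N ν : ℕ} (F : PolynomialFilterBank N ν) {H : Finset (Fin ν → ℤ)}

theorem fourierVec_mem_absorbed (hA : F.IsAbsorbing H) (n : Fin ν → ℤ) :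
    ∃ L, fourierVec n ∈ absorbed F.rep (fourierSpan H) L := by
  obtain ⟨L, hL⟩ := hA n
  exact ⟨L, mem_absorbed_of_forall_word L _ fun I hI => hL I hI.ge⟩

theorem isCyclicSubspace_fourierSpan (hA : F.IsAbsorbing H) :
    IsCyclicSubspace F.rep (fourierSpan H) := by
  set Z := Submodule.span ℂ {y | ∃ A ∈ cuntzAlgebra F.rep, ∃ x ∈ fourierSpan H, y = A x} with hZ
  have hK : fourierSpan H ≤ Z := fun x hx => Submodule.subset_span
    ⟨1, one_mem (StarAlgebra.adjoin ℂ (Set.range F.rep)).topologicalClosure, x, hx, rfl⟩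
  have hinv : ∀ j, ∀ x ∈ Z, F.rep j x ∈ Z := by
    intro j x hx
    induction hx using Submodule.span_induction with
    | mem x hx =>
      obtain ⟨A, hA, x, hx, rfl⟩ := hx
      exact Submodule.subset_span ⟨F.rep j * A,
        mul_mem (S := StarSubalgebra ℂ (TorusL2 ν →L[ℂ] TorusL2 ν)) (mem_cuntzAlgebra F.rep j) hA,
        x, hx, rfl⟩
    | zero => rw [map_zero]; exact Submodule.zero_mem _
    | add x y _ _ hx hy => rw [map_add]; exact Submodule.add_mem _ hx hy
    | smul c x _ hx => rw [map_smul]; exact Submodule.smul_mem _ _ hx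
  refine Submodule.dense_iff_topologicalClosure_eq_top.1 (dense_span_fourierVec.mono ?_)
  refine Submodule.span_le.2 ?_
  rintro _ ⟨n, rfl⟩
  obtain ⟨L, hL⟩ := F.fourierVec_mem_absorbed hA n
  exact absorbed_le_of_invariant F.isCuntzFamily hK hinv L hL

theorem eq_sum_of_mem_fourierSpan {x : TorusL2 ν} (hx : x ∈ fourierSpan H) :
    x = ∑ m : H, ⟪fourierVec m.1, x⟫_ℂ • fourierVec m.1 := by
  induction hx using Submodule.span_induction with
  | mem x hx =>
    obtain ⟨n, hn, rfl⟩ := hx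
    simp only [orthonormal_iff_ite.1 orthonormal_fourierVec]
    rw [Finset.sum_eq_single (⟨n, hn⟩ : H)]
    · simp
    · intro m _ hm
      rw [if_neg (fun h => hm (Subtype.ext h)), zero_smul]
    · simp
  | zero => simp
  | add x y _ _ hx hy =>
    simp only [inner_add_right, add_smul, Finset.sum_add_distrib]
    rw [← hx, ← hy]
  | smul c x _ hx =>
    simp only [inner_smul_right, mul_smul]
    rw [← Finset.smul_sum, ← hx]

/-- The coefficients defining V_j* are those of S_j* e_n on the basis vectors from H, and
coinvariance says that there are no others. -/
theorem coe_star_core_apply (hC : F.IsCoinvariant H) (j : Fin N) (k : fourierSpan H) :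
    (star (F.core H j) k : TorusL2 ν) = star (F.rep j) k := by
  have h0 : star (F.core H j) = F.coreAdjoint H j :=
    ContinuousLinearMap.adjoint_adjoint _
  rw [h0]
  obtain ⟨x, hx⟩ := k
  induction hx using Submodule.span_induction with
  | mem x hx =>
    obtain ⟨n, hn, rfl⟩ := hx
    have h := F.coreAdjoint_apply H j ⟨n, hn⟩
    have hmem := hC j _ (spanVec (⟨n, hn⟩ : H)).2
    refine (congrArg Subtype.val h).trans ?_
    rw [Submodule.coe_sum]
    refine Eq.trans ?_ (eq_sum_of_mem_fourierSpan hmem).symm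
    refine Finset.sum_congr rfl fun m _ => ?_
    exact congrArg (· • fourierVec m.1) (F.inner_fourierVec_star_rep j n m.1).symm
  | zero =>
    change ((F.coreAdjoint H j 0 : fourierSpan H) : TorusL2 ν) = star (F.rep j) 0
    rw [map_zero, map_zero]
    rfl
  | add x y hx hy h1 h2 =>
    have h := congrArg Subtype.val (map_add (F.coreAdjoint H j) ⟨x, hx⟩ ⟨y, hy⟩)
    refine h.trans ?_
    rw [Submodule.coe_add, h1, h2]
    exact (map_add (star (F.rep j)) x y).symm
  | smul c x hx h1 =>
    have h := congrArg Subtype.val (map_smul (F.coreAdjoint H j) c ⟨x, hx⟩)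
    refine h.trans ?_
    rw [Submodule.coe_smul, h1]
    exact (map_smul (star (F.rep j)) c x).symm

theorem isCore (hA : F.IsAbsorbing H) (hC : F.IsCoinvariant H) :
    IsCore F.rep (fourierSpan H) (F.core H) where
  cuntz := F.isCuntzFamily
  coe_star_apply := F.coe_star_core_apply hC
  dense := by
    refine dense_span_fourierVec.mono fun x hx => ?_
    rw [Set.mem_iUnion]
    have hmono := absorbed_mono hC
    induction hx using Submodule.span_induction with
    | mem x hx => obtain ⟨n, rfl⟩ := hx; exact F.fourierVec_mem_absorbed hA n
    | zero => exact ⟨0, Submodule.zero_mem _⟩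
    | add x y _ _ hx hy =>
      obtain ⟨n, hn⟩ := hx
      obtain ⟨m, hm⟩ := hy
      exact ⟨max n m, Submodule.add_mem _ (hmono (le_max_left n m) hn)
        (hmono (le_max_right n m) hm)⟩
    | smul c x _ hx =>
      obtain ⟨n, hn⟩ := hx
      exact ⟨n, Submodule.smul_mem _ _ hn⟩

end PolynomialFilterBank

end AbsorbingSets

/-- The identity is a fixed point of norm 1, and its compression has the same norm. -/
theorem IsCore.nontrivial_core {N : ℕ} {E : Type*} [NormedAddCommGroup E]
    [InnerProductSpace ℂ E] [CompleteSpace E] [Nontrivial E] {S : Fin N → E →L[ℂ] E}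
    {K : Submodule ℂ E} [CompleteSpace K] {V : Fin N → K →L[ℂ] K} (hV : IsCore S K V) :
    Nontrivial K := by
  by_contra h
  rw [not_nontrivial_iff_subsingleton] at h
  have h1 := hV.norm_eq_norm_compress hV hV.cuntz.transferMap_one
  have h2 : compress K K (1 : E →L[ℂ] E) = 0 := by
    ext1 x
    exact Subsingleton.elim _ _
  rw [h2, ContinuousLinearMap.opNorm_zero, norm_one] at h1
  exact zero_ne_one h1

instance {ν : ℕ} : Nontrivial (TorusL2 ν) :=
  ⟨⟨fourierVec 0, 0, fun h => by
    have h1 := orthonormal_fourierVec.1 (0 : Fin ν → ℤ)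
    rw [h, norm_zero] at h1
    exact zero_ne_one h1⟩⟩

theorem IsCore.exists_commutant_equiv {N : ℕ} {E : Type*} [NormedAddCommGroup E]
    [InnerProductSpace ℂ E] [CompleteSpace E] {S : Fin N → E →L[ℂ] E}
    {K : Submodule ℂ E} [CompleteSpace K] {V : Fin N → K →L[ℂ] K} (hV : IsCore S K V) :
    ∃ Φ : commutant S ≃ₗᵢ[ℂ] transferFixedPoints V V,
      (∀ X, (Φ X : K →L[ℂ] K) = compress K K (X : E →L[ℂ] E)) ∧
      ∀ X Y : commutant S, (X : E →L[ℂ] E) ≤ Y ↔ (Φ X : K →L[ℂ] K) ≤ Φ Y := by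
  rw [commutant_eq_intertwiners hV.cuntz]
  obtain ⟨Φ, hΦ⟩ := hV.exists_compressEquiv hV
  refine ⟨Φ, hΦ, fun X Y => ?_⟩
  have h := hV.nonneg_iff_compress_nonneg ((mem_intertwiners_iff hV.cuntz _).1 (Y - X).2)
  rw [← hΦ, map_sub, Submodule.coe_sub, Submodule.coe_sub,
    ContinuousLinearMap.nonneg_iff_isPositive, ContinuousLinearMap.nonneg_iff_isPositive] at h
  rw [ContinuousLinearMap.le_def, ContinuousLinearMap.le_def]
  exact h

end

theorem corollary3p3 {N ν : ℕ} (F : PolynomialFilterBank N ν)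
    (hF : F.IsExpansive) :
    IsCuntzFamily F.rep ∧
    (∃ H, Minimal (fun H => F.IsAbsorbing H ∧ F.IsCoinvariant H) H) ∧
    IsFinitelyCorrelated F.rep ∧
    (∀ H, F.IsAbsorbing H → IsCyclicSubspace F.rep (fourierSpan H)) ∧
    ∀ H, F.IsAbsorbing H → F.IsCoinvariant H →
      (∃ Φ : commutant F.rep ≃ₗᵢ[ℂ] transferFixedPoints (F.core H) (F.core H),
        (∀ X, (Φ X : fourierSpan H →L[ℂ] fourierSpan H) =
          compress (fourierSpan H) (fourierSpan H) (X : TorusL2 ν →L[ℂ] TorusL2 ν)) ∧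
        ∀ X Y : commutant F.rep, (X : TorusL2 ν →L[ℂ] TorusL2 ν) ≤ Y ↔
          (Φ X : fourierSpan H →L[ℂ] fourierSpan H) ≤ Φ Y) ∧
      (IsIrreducibleRep F.rep ↔
        transferFixedPoints (F.core H) (F.core H) = Submodule.span ℂ {1}) ∧
      (IsIrreducibleRep F.rep →
        ∃ G : Subgroup Circle, Finite G ∧ IsCyclic G ∧
          peripheralSpectrum (transferMap (F.core H) (F.core H)) =
            ((↑) : Circle → ℂ) '' (G : Set Circle) ∧
          ∃ W : Fin (Nat.card G) → Submodule ℂ (TorusL2 ν),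
            (∀ i, IsIrreducibleOn (uhfAlgebra F.rep) (W i)) ∧
            (∀ i j, i ≠ j → W i ⟂ W j) ∧
            (⨆ i, W i) = ⊤ ∧
            ∀ i j, i ≠ j → AreDisjointOn (uhfAlgebra F.rep) (W i) (W j)) ∧
      ∀ (ν' : ℕ) (F' : PolynomialFilterBank N ν') (H' : Finset (Fin ν' → ℤ)),
        F'.IsAbsorbing H' → F'.IsCoinvariant H' →
        ∃ Ψ : intertwiners F.rep F'.rep ≃ₗᵢ[ℂ] transferFixedPoints (F.core H) (F'.core H'),
          ∀ U, (Ψ U : fourierSpan H →L[ℂ] fourierSpan H') =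
            compress (fourierSpan H) (fourierSpan H') (U : TorusL2 ν →L[ℂ] TorusL2 ν') := by
  -- Strict inclusion of finite sets is well founded, so existence alone yields a minimal H.
  have hmin := exists_minimal_of_wellFoundedLT
    (fun H => F.IsAbsorbing H ∧ F.IsCoinvariant H) (F.exists_absorbing_coinvariant hF)
  obtain ⟨H₀, hA₀, hC₀⟩ := F.exists_absorbing_coinvariant hF
  refine ⟨F.isCuntzFamily, hmin, ⟨fourierSpan H₀, inferInstance, hC₀,
    F.isCyclicSubspace_fourierSpan hA₀⟩, fun H hA => F.isCyclicSubspace_fourierSpan hA,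
    fun H hA hC => ?_⟩
  have hV := F.isCore hA hC
  have := hV.nontrivial_core
  have hN : 0 < N := by have := F.two_le; omega
  refine ⟨hV.exists_commutant_equiv, hV.isIrreducibleRep_iff, fun hirr => ?_,
    fun ν' F' H' hA' hC' => hV.exists_compressEquiv (F'.isCore hA' hC')⟩
  exact ⟨hV.eigenGroup hirr, hV.finite_eigenGroup hirr, hV.isCyclic_eigenGroup hirr,
    hV.peripheralSpectrum_eq hirr, hV.exists_uhf_decomposition hirr ⟨0, hN⟩⟩
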